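/- Let $K$ be a field and let $\Gamma=(S,Y)$ be a graph in the sense of Serre with finitely many vertices and edges: every edge $y\in Y$ has an origin $o(y)$, a terminus $t(y)$ and an inverse edge $\bar y\neq y$ with $\bar{\bar y}=y$ and $o(y)=t(\bar y)$ (loops and multiple edges are allowed). Let $Y_1\subseteq Y$ satisfy $\overline{Y_1}=Y_1$, and for each $y\in Y_1$ let $f_y\in K[t]$ be a non-constant polynomial with non-zero constant term such that $f_y=f_{\bar y}$. Let $K\Gamma$ be the path algebra, whose $K$-basis is the set of all paths in $\Gamma$ (including, for each vertex $s$, the path $[s]$ of length $0$), with concatenation as product and product $0$ for non-composable paths. Let $R_{\mathfrak F}$ be the quotient of $K\Gamma$ by the two-sided ideal generated by all $f_y(y\bar y)$ with $y\in Y_1$, where $f_y(y\bar y)$ is evaluated in the ring $[o(y)]K\Gamma[o(y)]$ with identity $[o(y)]$. A spanning tree of $\Gamma$ is a subgraph $T=(S,Y^T)$ that contains all vertices, is non-empty and connected, and has no circuits, i.e. no closed paths of positive length without backtracking. An orientation of $\Gamma$ is a subset $Y^+\subseteq Y$ with $Y=Y^+\sqcup\overline{Y^+}$. For a spanning tree $T$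 with $Y^T\subseteq Y_1$ and an orientation $Y^+$, let $Q(T,Y^+)$ be the free product (coproduct) of $K$-algebras over $K$ of the following family: \[ \begin{cases} K[t]/(f_y) & \text{one for each } y\in Y_1\cap Y^+,\\ K[z_y,z_y^{-1}] & \text{one for each } y\in (Y_1\cap Y^+)\setminus (Y^T\cap Y^+),\\ K\langle x_y,\bar x_y\rangle & \text{one for each } y\in Y^+\setminus (Y_1\cap Y^+), \end{cases} \] where $K[z_y,z_y^{-1}]$ is the ring of Laurent polynomials and $K\langle x_y,\bar x_y\rangle$ is the free algebra on two non-commuting variables. Then: (a) For every spanning tree $T=(S,Y^T)$ of $\Gamma$ with $Y^T\subseteq Y_1$ there is an orientation $Y^+$ of $\Gamma$ such that $R_{\mathfrak F}\cong M_N(Q(T,Y^+))$ as unital $K$-algebras, where $N$ is the cardinality of $S$. (b) Up to isomorphism of $K$-algebras, $Q$ does not depend on the choice of the spanning tree or of the orientation: $Q(T,Y^+)\cong Q(T',Y'^+)$ for all spanning trees $T,T'$ with $Y^T,Y^{T'}\subseteq Y_1$ and all orientations $Y^+,Y'^+$ of $\Gamma$. (c) For every non-constant $f\in K[t]$ with non-zero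 constant term, \[ K\langle x,\bar x\rangle/\big(f(x\bar x),f(\bar x x)\big)\;\cong\; K[z,z^{-1}] *_K K[t]/(f) \] as $K$-algebras. -/

import Mathlib

open Polynomial

universe u v w

/-- A graph with vertex set `S` and edge set `Y` in the sense of Serre: each edge has an origin,
a terminus and an inverse edge different from it. Loops and multiple edges are allowed. -/
structure SerreGraph (S : Type v) (Y : Type w) where
  /-- origin -/
  o : Y → S
  /-- terminus -/
  t : Y → S
  /-- inverse edge -/
  bar : Y → Y
  bar_bar : ∀ y, bar (bar y) = y
  bar_ne : ∀ y, bar y ≠ y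
  o_eq : ∀ y, o y = t (bar y)

namespace SerreGraph

variable {S : Type v} {Y : Type w} (Γ : SerreGraph S Y)

/-! ### Paths -/

/-- The edges of the list can be traversed one after the other, starting at the given vertex. -/
def IsWalkFrom : S → List Y → Prop
  | _, [] => True
  | s, y :: l => Γ.o y = s ∧ IsWalkFrom (Γ.t y) l

/-- The vertex that is reached from the given vertex by traversing the edges of the list. -/
def endVertex : S → List Y → S
  | s, [] => s
  | _, y :: l => endVertex (Γ.t y) l

/-- A path: a first vertex and a list of composable edges, the first of which (if any) starts
at that vertex. The paths of length zero are the vertices. -/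
@[ext] structure Path where
  src : S
  edges : List Y
  isWalk : Γ.IsWalkFrom src edges

variable {Γ}

/-- The last vertex of a path. -/
def Path.tgt (p : Γ.Path) : S := Γ.endVertex p.src p.edges

theorem isWalkFrom_append {s : S} {l m : List Y} :
    Γ.IsWalkFrom s (l ++ m) ↔ Γ.IsWalkFrom s l ∧ Γ.IsWalkFrom (Γ.endVertex s l) m := by
  induction l generalizing s with
  | nil => simp [IsWalkFrom, endVertex]
  | cons y l ih => simp [IsWalkFrom, endVertex, ih, and_assoc]

theorem endVertex_append {s : S} {l m : List Y} :
    Γ.endVertex s (l ++ m) = Γ.endVertex (Γ.endVertex s l) m := by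
  induction l generalizing s with
  | nil => simp [endVertex]
  | cons y l ih => simp [endVertex, ih]

/-- Concatenation of composable paths. -/
def Path.comp (p q : Γ.Path) (h : p.tgt = q.src) : Γ.Path where
  src := p.src
  edges := p.edges ++ q.edges
  isWalk := isWalkFrom_append.2 ⟨p.isWalk, by
    have : Γ.endVertex p.src p.edges = q.src := h
    rw [this]; exact q.isWalk⟩

theorem Path.tgt_comp (p q : Γ.Path) (h : p.tgt = q.src) : (p.comp q h).tgt = q.tgt := by
  have : Γ.endVertex p.src p.edges = q.src := h
  simp [Path.tgt, Path.comp, endVertex_append, this]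

variable (Γ)

/-- The path of length zero at a vertex. -/
def Path.nil (s : S) : Γ.Path := ⟨s, [], trivial⟩

/-- The path of length one given by an edge. -/
def Path.ofEdge (y : Y) : Γ.Path := ⟨Γ.o y, [y], rfl, trivial⟩

variable {Γ}

/-- A path of length at least one, without backtracking, whose extremities agree. -/
def Path.IsCircuit (p : Γ.Path) : Prop :=
  p.edges ≠ [] ∧ p.src = p.tgt ∧ p.edges.IsChain (fun y z => z ≠ Γ.bar y)

variable (Γ)

/-! ### Spanning trees and orientations -/

/-- The set of edges `T` is the edge set of a spanning tree `(S, T)`: it is stable under inversion,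
and the subgraph with all vertices and the edges in `T` is non-empty, connected and has
no circuits. -/
structure IsSpanningTree (T : Set Y) : Prop where
  bar_mem : ∀ y ∈ T, Γ.bar y ∈ T
  nonempty : Nonempty S
  connected : ∀ a b : S, ∃ p : Γ.Path, p.src = a ∧ p.tgt = b ∧ ∀ y ∈ p.edges, y ∈ T
  no_circuit : ∀ p : Γ.Path, (∀ y ∈ p.edges, y ∈ T) → ¬ p.IsCircuit

/-- An orientation: `Y` is the disjoint union of `P` and the set of inverses of edges in `P`. -/
def IsOrientation (P : Set Y) : Prop :=
  P ∪ Γ.bar '' P = Set.univ ∧ Disjoint P (Γ.bar '' P)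

/-! ### The path algebra -/

/-- The path algebra over `A`, as the free `A`-module on the paths. -/
def PathAlgebra (A : Type u) [CommRing A] (Γ : SerreGraph S Y) : Type (max u v w) := Γ.Path →₀ A

namespace PathAlgebra

variable (A : Type u) [CommRing A]

noncomputable instance : AddCommGroup (PathAlgebra A Γ) :=
  inferInstanceAs (AddCommGroup (Γ.Path →₀ A))

noncomputable instance : Module A (PathAlgebra A Γ) :=
  inferInstanceAs (Module A (Γ.Path →₀ A))

variable {Γ}

/-- The basis element given by a path. -/
noncomputable def ofPath (p : Γ.Path) : PathAlgebra A Γ := Finsupp.single p 1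

open Classical in
/-- The product of two paths: their concatenation if they are composable, and `0` otherwise. -/
noncomputable def pathMul (p q : Γ.Path) : PathAlgebra A Γ :=
  if h : p.tgt = q.src then ofPath A (p.comp q h) else 0

/-- The linear map with prescribed values on the basis of paths. -/
noncomputable def liftLin {M : Type*} [AddCommMonoid M] [Module A M] (g : Γ.Path → M) :
    PathAlgebra A Γ →ₗ[A] M :=
  Finsupp.linearCombination A g

theorem liftLin_ofPath {M : Type*} [AddCommMonoid M] [Module A M] (g : Γ.Path → M) (p : Γ.Path) :
    liftLin A g (ofPath A p) = g p :=
  (Finsupp.linearCombination_single A (1 : A) p).trans (one_smul A _)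

/-- The bilinear extension of the product of paths. -/
noncomputable def mulLin :
    PathAlgebra A Γ →ₗ[A] PathAlgebra A Γ →ₗ[A] PathAlgebra A Γ :=
  liftLin A fun p => liftLin A fun q => pathMul A p q

noncomputable instance : Mul (PathAlgebra A Γ) := ⟨fun a b => mulLin A a b⟩

/-- The sum of all vertices. -/
noncomputable instance [Fintype S] : One (PathAlgebra A Γ) := ⟨∑ s : S, ofPath A (Path.nil Γ s)⟩

theorem mul_eq (a b : PathAlgebra A Γ) : a * b = mulLin A a b := rfl

theorem one_eq [Fintype S] : (1 : PathAlgebra A Γ) = ∑ s : S, ofPath A (Path.nil Γ s) := rfl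

theorem ofPath_mul_ofPath (p q : Γ.Path) : ofPath A p * ofPath A q = pathMul A p q := by
  rw [mul_eq, mulLin, liftLin_ofPath, liftLin_ofPath]

theorem hom_ext {M : Type*} [AddCommMonoid M] [Module A M] {f g : PathAlgebra A Γ →ₗ[A] M}
    (h : ∀ p, f (ofPath A p) = g (ofPath A p)) : f = g :=
  Finsupp.lhom_ext' fun p => LinearMap.ext_ring (h p)

theorem ofPath_assoc (p q r : Γ.Path) :
    ofPath A p * ofPath A q * ofPath A r = ofPath A p * (ofPath A q * ofPath A r) := by
  rw [ofPath_mul_ofPath, ofPath_mul_ofPath]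
  unfold pathMul
  by_cases h : p.tgt = q.src <;> by_cases h' : q.tgt = r.src
  · have h1 : (p.comp q h).tgt = r.src := by rw [Path.tgt_comp, h']
    have h2 : p.tgt = (q.comp r h').src := h
    rw [dif_pos h, dif_pos h', ofPath_mul_ofPath, ofPath_mul_ofPath, pathMul, pathMul,
      dif_pos h1, dif_pos h2]
    congr 1
    ext1
    · rfl
    · simp [Path.comp]
  · have h1 : ¬ (p.comp q h).tgt = r.src := by rw [Path.tgt_comp]; exact h'
    rw [dif_pos h, dif_neg h', ofPath_mul_ofPath, pathMul, dif_neg h1]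
    simp [mul_eq]
  · have h2 : ¬ p.tgt = (q.comp r h').src := h
    rw [dif_neg h, dif_pos h', ofPath_mul_ofPath, pathMul, dif_neg h2]
    simp [mul_eq]
  · rw [dif_neg h, dif_neg h']
    simp [mul_eq]

theorem mul_assoc' (a b c : PathAlgebra A Γ) : a * b * c = a * (b * c) := by
  let L : PathAlgebra A Γ →ₗ[A] PathAlgebra A Γ →ₗ[A] PathAlgebra A Γ := mulLin A
  let F : PathAlgebra A Γ →ₗ[A] PathAlgebra A Γ →ₗ[A] PathAlgebra A Γ →ₗ[A] PathAlgebra A Γ :=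
    LinearMap.compr₂ L L
  let G : PathAlgebra A Γ →ₗ[A] PathAlgebra A Γ →ₗ[A] PathAlgebra A Γ →ₗ[A] PathAlgebra A Γ :=
    LinearMap.compl₂ (LinearMap.llcomp A (PathAlgebra A Γ) (PathAlgebra A Γ) (PathAlgebra A Γ) ∘ₗ L)
      L
  have : F = G := hom_ext A fun p => hom_ext A fun q => hom_ext A fun r => ofPath_assoc A p q r
  exact LinearMap.congr_fun (LinearMap.congr_fun (LinearMap.congr_fun this a) b) c

theorem one_mul' [Fintype S] (a : PathAlgebra A Γ) : 1 * a = a := by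
  have : mulLin A (1 : PathAlgebra A Γ) = LinearMap.id := by
    refine hom_ext A fun p => ?_
    have hp : ∀ s : S, mulLin A (ofPath A (Path.nil Γ s)) (ofPath A p)
        = pathMul A (Path.nil Γ s) p := fun s => ofPath_mul_ofPath A _ _
    rw [one_eq, map_sum, LinearMap.sum_apply]
    simp only [hp]
    rw [Finset.sum_eq_single p.src]
    · rw [pathMul, dif_pos (show (Path.nil Γ p.src).tgt = p.src from rfl)]; rfl
    · intro s _ hs; rw [pathMul, dif_neg]; exact hs
    · simp
  exact LinearMap.congr_fun this a

theorem mul_one' [Fintype S] (a : PathAlgebra A Γ) : a * 1 = a := by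
  have : (mulLin A (Γ := Γ)).flip (1 : PathAlgebra A Γ) = LinearMap.id := by
    refine hom_ext A fun p => ?_
    have hp : ∀ s : S, mulLin A (ofPath A p) (ofPath A (Path.nil Γ s))
        = pathMul A p (Path.nil Γ s) := fun s => ofPath_mul_ofPath A _ _
    rw [one_eq, LinearMap.flip_apply, map_sum]
    simp only [hp]
    rw [Finset.sum_eq_single p.tgt]
    · rw [pathMul, dif_pos (show p.tgt = (Path.nil Γ p.tgt).src from rfl)]
      simp [Path.comp, Path.nil]
    · intro s _ hs; rw [pathMul, dif_neg]; exact fun h => hs h.symm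
    · simp
  exact LinearMap.congr_fun this a

noncomputable instance [Fintype S] : Ring (PathAlgebra A Γ) where
  __ := (inferInstance : AddCommGroup (PathAlgebra A Γ))
  left_distrib a b c := by simp [mul_eq]
  right_distrib a b c := by simp [mul_eq]
  zero_mul a := by simp [mul_eq]
  mul_zero a := by simp [mul_eq]
  mul_assoc := mul_assoc' A
  one_mul := one_mul' A
  mul_one := mul_one' A

noncomputable instance [Fintype S] : Algebra A (PathAlgebra A Γ) :=
  Algebra.ofModule (fun r a b => by simp [mul_eq]) (fun r a b => by simp [mul_eq])

variable (Γ)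

/-- The idempotent of the path algebra given by a vertex. -/
noncomputable def vertex (s : S) : PathAlgebra A Γ := ofPath A (Path.nil Γ s)

/-- The element of the path algebra given by an edge. -/
noncomputable def edge (y : Y) : PathAlgebra A Γ := ofPath A (Path.ofEdge Γ y)

variable {A}

/-- The value of the polynomial `f` at `y ȳ` in the ring `[o(y)] AΓ [o(y)]` with identity `[o(y)]`:
the sum of the `aₙ • (y ȳ) ^ n` where `f = ∑ aₙ t ^ n` and `(y ȳ) ^ 0` is read as `[o(y)]`. -/
noncomputable def evalAt [Fintype S] (f : A[X]) (y : Y) : PathAlgebra A Γ :=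
  f.sum fun n a => a • (vertex Γ A (Γ.o y) * (edge Γ A y * edge Γ A (Γ.bar y)) ^ n)

end PathAlgebra

/-! ### The quotient of the path algebra -/

/-- Property F of the family of polynomials `(f y)`, `y ∈ Y₁`. The values of `f` outside `Y₁`
play no role. -/
structure PropertyF {A : Type u} [CommRing A] (Y₁ : Set Y) (f : Y → A[X]) : Prop where
  bar_image : Γ.bar '' Y₁ = Y₁
  nonconstant : ∀ y ∈ Y₁, (f y).natDegree ≠ 0
  bar_eq : ∀ y ∈ Y₁, f y = f (Γ.bar y)
  isUnit_coeff_zero : ∀ y ∈ Y₁, IsUnit ((f y).coeff 0)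

/-- The two-sided ideal of the path algebra generated by the `f_y (y ȳ)` with `y ∈ Y₁`. -/
noncomputable def relationIdeal [Fintype S] {A : Type u} [CommRing A] (Y₁ : Set Y) (f : Y → A[X]) :
    TwoSidedIdeal (PathAlgebra A Γ) :=
  TwoSidedIdeal.span {x | ∃ y ∈ Y₁, x = PathAlgebra.evalAt Γ (f y) y}

/-- The quotient of the path algebra by the ideal generated by the `f_y (y ȳ)` with `y ∈ Y₁`. -/
abbrev RelationQuotient [Fintype S] {A : Type u} [CommRing A] (Y₁ : Set Y) (f : Y → A[X]) :
    Type (max u v w) :=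
  (Γ.relationIdeal Y₁ f).ringCon.Quotient

end SerreGraph

/-! ### The factors and their free product -/

/-- The three kinds of factors over `K`. -/
inductive FactorKind (K : Type u) [Field K] : Type u
  /-- the ring `K[t] / (f)` -/
  | root (f : K[X])
  /-- the ring `K[z, z⁻¹]` of Laurent polynomials -/
  | laurent
  /-- the free algebra on two generators -/
  | free

namespace FactorKind

variable {K : Type u} [Field K]

/-- The ring described by a kind of factor. -/
def Carrier : FactorKind K → Type u
  | root f => K[X] ⧸ Ideal.span {f}
  | laurent => LaurentPolynomial K
  | free => FreeAlgebra K (Fin 2)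

noncomputable instance : (k : FactorKind K) → Semiring k.Carrier
  | root f => inferInstanceAs (Semiring (K[X] ⧸ Ideal.span {f}))
  | laurent => inferInstanceAs (Semiring (LaurentPolynomial K))
  | free => inferInstanceAs (Semiring (FreeAlgebra K (Fin 2)))

noncomputable instance : (k : FactorKind K) → Algebra K k.Carrier
  | root f => inferInstanceAs (Algebra K (K[X] ⧸ Ideal.span {f}))
  | laurent => inferInstanceAs (Algebra K (LaurentPolynomial K))
  | free => inferInstanceAs (Algebra K (FreeAlgebra K (Fin 2)))

end FactorKind

open Classical in
/-- The free product over `K` (the coproduct of `K`-algebras) of a family of factors. -/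
abbrev FactorProduct (K : Type u) [Field K] {I : Type w} (k : I → FactorKind K) : Type (max u w) :=
  LinearAlgebra.FreeProduct K fun i => (k i).Carrier

namespace SerreGraph

variable {S : Type v} {Y : Type w}

/-- The factors attached to a set `Y₁` of edges, polynomials `f`, a spanning tree `T` and an
orientation `P`: the ring `K[t] / (f y)` for each `y ∈ Y₁ ∩ P`, a ring of Laurent polynomials
for each `y ∈ (Y₁ ∩ P) \ (T ∩ P)`, and a free algebra on two generators for each
`y ∈ P \ (Y₁ ∩ P)`. -/
def factors {K : Type u} [Field K] (Y₁ : Set Y) (f : Y → K[X]) (T P : Set Y) :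
    ↥(Y₁ ∩ P) ⊕ ↥((Y₁ ∩ P) \ (T ∩ P)) ⊕ ↥(P \ (Y₁ ∩ P)) → FactorKind K :=
  Sum.elim (fun y => .root (f y)) (Sum.elim (fun _ => .laurent) (fun _ => .free))

end SerreGraph

/-- The quotient of the free algebra on `x = ι 0` and `x̄ = ι 1` by the two-sided ideal generated
by `f(x x̄)` and `f(x̄ x)`. -/
abbrev EdgeAlgebra (K : Type u) [Field K] (f : K[X]) : Type u :=
  (TwoSidedIdeal.span
    {aeval (FreeAlgebra.ι K (0 : Fin 2) * FreeAlgebra.ι K (1 : Fin 2)) f,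
      aeval (FreeAlgebra.ι K (1 : Fin 2) * FreeAlgebra.ι K (0 : Fin 2)) f}).ringCon.Quotient

/-!
In the quotient `R` of the path algebra, the relations `f_y (y ȳ) = 0` and `f_y (ȳ y) = 0` make every
edge `y ∈ Y₁` an isomorphism between the idempotents of its endpoints, because `f_y` has a non-zero
constant term (`exists_inverse_of_aeval_mul`). Composing these isomorphisms along the paths of
a spanning tree `T ⊆ Y₁`, with the edges of `T ∩ P` represented by themselves, gives a system of matrix
units `e i j` of `R` (`SerreGraph.IsTransport.exists_isMatrixUnits`); it is well defined because
a closed path in a tree has backtracking, which cancels. Hence `R` is a matrix ring over the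
centralizer of the `e i j`.

The free product `Q` is generated by elements attached to the edges (`SerreGraph.edgeGen`), and these
are universal for the relations `f_y (y ȳ) = 0`, `y ∈ Y₁`, together with `y = 1` for `y ∈ T ∩ P`
(`SerreGraph.exists_edgeProduct_hom`, `SerreGraph.edgeProduct_hom_ext`). The edges, moved to
the centralizer by means of the matrix units, satisfy these relations, which gives
a homomorphism from the matrix ring over `Q` to `R`. The homomorphism in the other direction sends
an edge from `i` to `j` to the elementary matrix at `(i, j)` with the corresponding generator as its
entry, and the two are inverse to each other (`SerreGraph.exists_algEquiv_matrix`). This works for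
every orientation `P`.

The isomorphism sends the vertices to the diagonal elementary matrices. So `Q` is isomorphic
to the corner of `R` at any vertex, which involves neither the tree nor the orientation
(`nonempty_algEquiv_of_matrix`). The algebra of one edge is treated directly by writing
`x = z` and `x̄ = z⁻¹ t` (`nonempty_edgeAlgebra_algEquiv`).
-/

/-! ### Inverses from a polynomial relation -/

section Inverse

variable {K A : Type*} [Field K] [Ring A] [Algebra K A]

/-- If `a` runs from the idempotent `e` to the idempotent `e'`, `b` runs back, and both `a b` and
`b a` are annihilated in the respective corner by a polynomial with non-zero constant term, then
`a b` and `b a` are invertible in the corners, so `a` is an isomorphism of `e` and `e'`. -/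
theorem exists_inverse_of_aeval_mul {f : K[X]} (h0 : f.coeff 0 ≠ 0) {e e' a b : A}
    (he : e * e = e) (ea : e * a = a) (e'b : e' * b = b) (be : b * e = b)
    (h1 : e * aeval (a * b) f = 0) (h2 : e' * aeval (b * a) f = 0) :
    ∃ c, e' * c = c ∧ c * e = c ∧ a * c = e ∧ c * a = e' := by
  have key : ∀ x : A, aeval x f = x * aeval x f.divX + algebraMap K A (f.coeff 0) := fun x => by
    conv_lhs => rw [← X_mul_divX_add f, map_add, map_mul, aeval_X, aeval_C]
  have h1' : a * b * aeval (a * b) f.divX * e = -(f.coeff 0 • e) := by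
    have := congrArg (· * e) h1
    simp only [key, mul_add, zero_mul, add_mul] at this
    rw [← Algebra.commutes, mul_assoc _ e e, he, ← Algebra.smul_def] at this
    rw [← mul_assoc, ← mul_assoc, ea] at this
    exact eq_neg_of_add_eq_zero_left this
  have h2' : e' * aeval (b * a) f.divX * (b * a) = -(f.coeff 0 • e') := by
    have hc : Commute (b * a) (aeval (b * a) f.divX) := by
      simpa using (Commute.all (X : K[X]) f.divX).map (aeval (R := K) (b * a))
    have := h2
    rw [key, hc.eq, mul_add, ← Algebra.commutes, ← Algebra.smul_def, ← mul_assoc] at this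
    exact eq_neg_of_add_eq_zero_left this
  -- with `f = t h + f(0)`, the right and the left inverse of `a` given by `-h / f(0)`
  set c := -((f.coeff 0)⁻¹ • (b * aeval (a * b) f.divX * e)) with hc
  set c' := -((f.coeff 0)⁻¹ • (e' * aeval (b * a) f.divX * b)) with hc'
  have ac : a * c = e := by
    rw [hc, mul_neg, mul_smul_comm, ← mul_assoc, ← mul_assoc, h1', smul_neg, neg_neg,
      inv_smul_smul₀ h0]
  have ca : c' * a = e' := by
    rw [hc', neg_mul, smul_mul_assoc, mul_assoc, h2', smul_neg, neg_neg, inv_smul_smul₀ h0]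
  have e'c : e' * c = c := by
    rw [hc, mul_neg, mul_smul_comm, ← mul_assoc, ← mul_assoc, e'b]
  have ce : c' * e = c' := by rw [hc', neg_mul, smul_mul_assoc, mul_assoc _ b, be]
  have hcc : c = c' := by rw [← e'c, ← ca, mul_assoc, ac, ce]
  exact ⟨c, e'c, by rw [hcc, ce], ac, by rw [hcc, ca]⟩

theorem isUnit_of_aeval_mul {f : K[X]} (h0 : f.coeff 0 ≠ 0) {a b : A}
    (h1 : aeval (a * b) f = 0) (h2 : aeval (b * a) f = 0) : IsUnit a := by
  obtain ⟨c, -, -, h, h'⟩ := exists_inverse_of_aeval_mul h0 (e := 1) (e' := 1) (a := a) (b := b)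
    (by simp) (by simp) (by simp) (by simp) (by simpa) (by simpa)
  exact ⟨⟨a, c, h, h'⟩, rfl⟩

theorem map_inv_units_of_eq {M N F : Type*} [Monoid M] [Monoid N] [FunLike F M N]
    [MonoidHomClass F M N] {φ : F} {u : Mˣ} {v : Nˣ} (h : φ u = v) : φ ↑u⁻¹ = ↑v⁻¹ := by
  refine left_inv_eq_right_inv (a := φ u) ?_ ?_
  · rw [← map_mul, Units.inv_mul, map_one]
  · rw [h, Units.mul_inv]

theorem aeval_units_conj {K A : Type*} [CommSemiring K] [Semiring A] [Algebra K A] (u : Aˣ) (c : A)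
    (f : K[X]) : aeval (↑u⁻¹ * c * u) f = ↑u⁻¹ * aeval c f * u := by
  simp only [aeval_eq_sum_range, Units.conj_pow', Finset.mul_sum, Finset.sum_mul, mul_smul_comm,
    smul_mul_assoc]

end Inverse

/-! ### Homomorphisms out of a quotient by a generated ideal -/

section SpanQuotient

variable {K A B : Type*} [CommRing K] [Ring A] [Algebra K A] [Semiring B] [Algebra K B]

namespace TwoSidedIdeal

/-- The homomorphism out of the quotient by the ideal generated by `s` that is induced by
a homomorphism vanishing on `s`. -/
noncomputable def spanLift (s : Set A) (φ : A →ₐ[K] B) (h : ∀ x ∈ s, φ x = 0) :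
    (span s).ringCon.Quotient →ₐ[K] B :=
  RingCon.liftₐ _ φ <| RingCon.ringConGen_le.2 fun x y hxy => by
    change φ x = φ y
    rw [← sub_add_cancel x y, map_add, h _ hxy, zero_add]

theorem mk_eq_zero_of_mem {s : Set A} {x : A} (hx : x ∈ s) :
    (span s).ringCon.mkₐ K x = 0 :=
  Quotient.sound ((mem_iff _ _).1 (subset_span hx))

end TwoSidedIdeal

end SpanQuotient

/-! ### The factors -/

namespace FactorKind

variable {K : Type u} [Field K] {A : Type*} [Semiring A] [Algebra K A]

/-- The class of `t` in `K[t] / (f)`. -/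
noncomputable def rootGen (f : K[X]) : (root f).Carrier :=
  (Ideal.Quotient.mk (Ideal.span {f}) X :)

/-- The homomorphism out of `K[t] / (f)` that sends `t` to a root of `f`. -/
noncomputable def rootHom {f : K[X]} (a : A) (h : aeval a f = 0) : (root f).Carrier →ₐ[K] A :=
  (Ideal.Quotient.liftₐ (Ideal.span {f}) (aeval a) fun p hp => by
    obtain ⟨q, rfl⟩ := Ideal.mem_span_singleton'.1 hp
    rw [map_mul, h, mul_zero] :)

@[simp] theorem rootHom_rootGen {f : K[X]} (a : A) (h : aeval a f = 0) :
    rootHom a h (rootGen f) = a :=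
  aeval_X a

theorem aeval_rootGen (f : K[X]) : aeval (rootGen f) f = 0 := by
  have h : aeval (Ideal.Quotient.mk (Ideal.span {f}) X) f = 0 := by
    rw [← Ideal.Quotient.mkₐ_eq_mk K, aeval_algHom_apply, aeval_X_left_apply,
      Ideal.Quotient.mkₐ_eq_mk, Ideal.Quotient.eq_zero_iff_mem]
    exact Ideal.mem_span_singleton_self f
  exact h

theorem root_hom_ext {f : K[X]} {φ ψ : (root f).Carrier →ₐ[K] A}
    (h : φ (rootGen f) = ψ (rootGen f)) : φ = ψ := by
  have : ∀ φ ψ : K[X] ⧸ Ideal.span {f} →ₐ[K] A,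
      φ (Ideal.Quotient.mk _ X) = ψ (Ideal.Quotient.mk _ X) → φ = ψ := fun φ ψ h =>
    Ideal.Quotient.algHom_ext _ (Polynomial.algHom_ext h)
  exact this φ ψ h

/-- The variable `z` as a unit of `K[z, z⁻¹]`. -/
noncomputable def laurentGen : (laurent : FactorKind K).Carrierˣ :=
  (⟨LaurentPolynomial.T 1, LaurentPolynomial.T (-1),
    by rw [← LaurentPolynomial.T_add]; simp, by rw [← LaurentPolynomial.T_add]; simp⟩ :
    (LaurentPolynomial K)ˣ)

/-- The homomorphism out of `K[z, z⁻¹]` that sends `z` to a given unit. -/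
noncomputable def laurentHom (a : Aˣ) : (laurent : FactorKind K).Carrier →ₐ[K] A :=
  (AddMonoidAlgebra.lift K A ℤ ((Units.coeHom A).comp (zpowersHom Aˣ a)) :)

@[simp] theorem laurentHom_laurentGen (a : Aˣ) :
    laurentHom (K := K) a (laurentGen (K := K)) = (a : A) := by
  refine (AddMonoidAlgebra.lift_single _ (1 : ℤ) (1 : K)).trans ?_
  simp

theorem laurent_hom_ext {φ ψ : (laurent : FactorKind K).Carrier →ₐ[K] A}
    (h : φ (laurentGen (K := K)) = ψ (laurentGen (K := K))) : φ = ψ := by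
  have : ∀ φ ψ : LaurentPolynomial K →ₐ[K] A,
      φ (LaurentPolynomial.T 1) = ψ (LaurentPolynomial.T 1) → φ = ψ := fun φ ψ h => by
    refine AddMonoidAlgebra.algHom_ext' (MonoidHom.ext_mint ?_) (by ext)
    exact h
  exact this φ ψ h

/-- The two generators of the free algebra. -/
noncomputable def freeGen (i : Fin 2) : (free : FactorKind K).Carrier :=
  (FreeAlgebra.ι K i :)

/-- The homomorphism out of the free algebra that sends the two generators to given elements. -/
noncomputable def freeHom (a : Fin 2 → A) : (free : FactorKind K).Carrier →ₐ[K] A :=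
  (FreeAlgebra.lift K a :)

@[simp] theorem freeHom_freeGen (a : Fin 2 → A) (i : Fin 2) :
    freeHom (K := K) a (freeGen (K := K) i) = a i :=
  FreeAlgebra.lift_ι_apply a i

theorem free_hom_ext {φ ψ : (free : FactorKind K).Carrier →ₐ[K] A}
    (h : ∀ i, φ (freeGen (K := K) i) = ψ (freeGen (K := K) i)) : φ = ψ := by
  have : ∀ φ ψ : FreeAlgebra K (Fin 2) →ₐ[K] A,
      (∀ i, φ (FreeAlgebra.ι K i) = ψ (FreeAlgebra.ι K i)) → φ = ψ := fun φ ψ h =>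
    FreeAlgebra.hom_ext (funext h)
  exact this φ ψ h

end FactorKind

/-! ### The universal property of the free product -/

namespace FactorProduct

variable {K : Type u} [Field K] {I : Type w} (k : I → FactorKind K)
  {A : Type*} [Semiring A] [Algebra K A]

open Classical in
/-- The embedding of a factor into the free product. -/
noncomputable def incl (i : I) : (k i).Carrier →ₐ[K] FactorProduct K k :=
  LinearAlgebra.FreeProduct.ι K (fun i => (k i).Carrier) i

variable {k}

open Classical in
/-- The homomorphism out of the free product that is given by homomorphisms of the factors. -/
noncomputable def lift (φ : ∀ i, (k i).Carrier →ₐ[K] A) : FactorProduct K k →ₐ[K] A :=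
  LinearAlgebra.FreeProduct.lift K (fun i => (k i).Carrier) (fun {i} => φ i)

theorem lift_incl (φ : ∀ i, (k i).Carrier →ₐ[K] A) (i : I) (x : (k i).Carrier) :
    lift φ (incl k i x) = φ i x := by
  classical
  exact DFunLike.congr_fun (LinearAlgebra.FreeProduct.lift_comp_ι K (fun i => (k i).Carrier)
    (fun {i} => φ i)) x

theorem hom_ext {φ ψ : FactorProduct K k →ₐ[K] A}
    (h : ∀ i, φ.comp (incl k i) = ψ.comp (incl k i)) : φ = ψ := by
  classical
  exact (LinearAlgebra.FreeProduct.lift_unique K (fun i => (k i).Carrier)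
    (fun {i} => ψ.comp (incl k i)) φ h).trans
    (LinearAlgebra.FreeProduct.lift_unique K (fun i => (k i).Carrier)
      (fun {i} => ψ.comp (incl k i)) ψ fun _ => rfl).symm

end FactorProduct

/-! ### Matrix units -/

/-- The family `e` is a complete system of matrix units of the ring `R`. -/
structure IsMatrixUnits {ι R : Type*} [Fintype ι] [Semiring R] (e : ι → ι → R) : Prop where
  mul_same : ∀ i j k, e i j * e j k = e i k
  mul_of_ne : ∀ i j k l, j ≠ k → e i j * e k l = 0
  sum_diag : ∑ i, e i i = 1

namespace IsMatrixUnits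

variable {K R ι : Type*} [Field K] [Ring R] [Algebra K R] [Fintype ι] {e : ι → ι → R}

variable (K e) in
/-- The centralizer of a system of matrix units; the ring is a matrix ring over it. -/
abbrev centralizer : Subalgebra K R := Subalgebra.centralizer K (Set.range (Function.uncurry e))

theorem sum_mul (he : IsMatrixUnits e) (i j : ι) (f : ι → R) :
    (∑ s, f s * e j s) * e i j = f i * e j j := by
  rw [Finset.sum_mul, Finset.sum_eq_single i]
  · rw [mul_assoc, he.mul_same]
  · intro s _ hs
    rw [mul_assoc, he.mul_of_ne _ _ _ _ hs, mul_zero]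
  · simp

variable (K) in
/-- The element `∑ₛ eₛᵢ a eⱼₛ` of the centralizer of the matrix units. For `a` in `eᵢᵢ R eⱼⱼ` it is
the scalar matrix with the entry of the elementary matrix `a`. -/
def spread (he : IsMatrixUnits e) (i j : ι) : R →ₗ[K] centralizer K e where
  toFun a := ⟨∑ s, e s i * a * e j s, by
    rw [Subalgebra.mem_centralizer_iff]
    rintro _ ⟨⟨k, l⟩, rfl⟩
    simp only [Function.uncurry_apply_pair]
    rw [Finset.mul_sum, Finset.sum_mul, Finset.sum_eq_single l, Finset.sum_eq_single k]
    · simp only [← mul_assoc, he.mul_same]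
      simp only [mul_assoc, he.mul_same]
    · intro s _ hs
      rw [mul_assoc, he.mul_of_ne _ _ _ _ hs, mul_zero]
    · simp
    · intro s _ hs
      rw [← mul_assoc, ← mul_assoc, he.mul_of_ne _ _ _ _ hs.symm, zero_mul, zero_mul]
    · simp⟩
  map_add' a b := Subtype.ext <| by simp [mul_add, add_mul, Finset.sum_add_distrib]
  map_smul' c a := Subtype.ext <| by simp [Finset.smul_sum]

theorem coe_spread (he : IsMatrixUnits e) (i j : ι) (a : R) :
    (he.spread K i j a : R) = ∑ s, e s i * a * e j s := rfl

theorem spread_mul_spread (he : IsMatrixUnits e) (i j k l : ι) (a b : R) :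
    he.spread K i j a * he.spread K k l b = he.spread K i l (a * e j k * b) := by
  refine Subtype.ext ?_
  rw [Subalgebra.coe_mul, coe_spread, coe_spread, coe_spread, Finset.sum_mul]
  refine Finset.sum_congr rfl fun s _ => ?_
  rw [Finset.mul_sum, Finset.sum_eq_single s]
  · simp only [mul_assoc]
    simp only [← mul_assoc (e j s), he.mul_same]
  · intro r _ hr
    simp only [mul_assoc]
    rw [← mul_assoc (e j s), he.mul_of_ne _ _ _ _ hr.symm, zero_mul, mul_zero, mul_zero]
  · simp

theorem spread_unit (he : IsMatrixUnits e) (i j : ι) : he.spread K i j (e i j) = 1 := by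
  refine Subtype.ext ?_
  rw [coe_spread]
  simp only [he.mul_same]
  exact he.sum_diag

theorem spread_mul_unit (he : IsMatrixUnits e) (i j : ι) (a : R) :
    (he.spread K i j a : R) * e i j = e i i * a * e j j := by
  rw [coe_spread, he.sum_mul]

theorem aeval_spread (he : IsMatrixUnits e) (i : ι) {c : R} (h : e i i * c = c) (f : K[X]) :
    aeval (he.spread K i i c) f = he.spread K i i (e i i * aeval c f) := by
  have hpow : ∀ n : ℕ, he.spread K i i c ^ n = he.spread K i i (e i i * c ^ n) := fun n => by
    induction n with
    | zero => rw [pow_zero, pow_zero, mul_one, spread_unit]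
    | succ n ih =>
      rw [pow_succ, ih, spread_mul_spread, mul_assoc _ (e i i) c, h, mul_assoc, pow_succ]
  simp only [aeval_eq_sum_range, hpow, Finset.mul_sum, map_sum, mul_smul_comm, map_smul]

section MatrixHom

variable {Q : Type*} [Semiring Q] [Algebra K Q] [DecidableEq ι]

/-- The homomorphism from a matrix ring that sends the elementary matrices to the matrix units `e`
and is given on scalar matrices by a homomorphism to the centralizer of `e`. -/
def matrixHom (he : IsMatrixUnits e) (χ : Q →ₐ[K] centralizer K e) : Matrix ι ι Q →ₐ[K] R :=
  AlgHom.ofLinearMap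
    { toFun := fun M => ∑ i, ∑ j, (χ (M i j) : R) * e i j
      map_add' := fun M N => by simp [add_mul, Finset.sum_add_distrib]
      map_smul' := fun c M => by simp [Finset.smul_sum] }
    (by
      change ∑ i, ∑ j, (χ ((1 : Matrix ι ι Q) i j) : R) * e i j = 1
      rw [← he.sum_diag]
      refine Finset.sum_congr rfl fun i _ => ?_
      rw [Finset.sum_eq_single i]
      · simp
      · intro j _ hj
        simp [Matrix.one_apply_ne hj.symm]
      · simp)
    (fun M N => by
      change ∑ i, ∑ j, (χ ((M * N) i j) : R) * e i j =
        (∑ i, ∑ j, (χ (M i j) : R) * e i j) * (∑ i, ∑ j, (χ (N i j) : R) * e i j)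
      have hcomm : ∀ (q : Q) (i j : ι), e i j * (χ q : R) = (χ q : R) * e i j := fun q i j =>
        Subalgebra.mem_centralizer_iff K |>.1 (χ q).2 _ ⟨(i, j), rfl⟩
      rw [Finset.sum_mul]
      refine Finset.sum_congr rfl fun i _ => ?_
      rw [Finset.sum_mul]
      simp only [Matrix.mul_apply, map_sum, map_mul, AddSubmonoidClass.coe_finsetSum,
        Subalgebra.coe_mul, Finset.sum_mul]
      rw [Finset.sum_comm]
      refine Finset.sum_congr rfl fun k _ => Eq.symm ?_
      rw [Finset.mul_sum, Finset.sum_eq_single k]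
      · rw [Finset.mul_sum]
        refine Finset.sum_congr rfl fun j _ => ?_
        rw [mul_assoc _ (e i k), ← mul_assoc (e i k), hcomm, mul_assoc _ (e i k), he.mul_same,
          mul_assoc]
      · intro l _ hl
        rw [Finset.mul_sum]
        refine Finset.sum_eq_zero fun j _ => ?_
        rw [mul_assoc _ (e i k), ← mul_assoc (e i k), hcomm, mul_assoc _ (e i k),
          he.mul_of_ne _ _ _ _ hl.symm, mul_zero, mul_zero]
      · simp)

theorem matrixHom_single (he : IsMatrixUnits e) (χ : Q →ₐ[K] centralizer K e) (i j : ι) (q : Q) :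
    he.matrixHom χ (Matrix.single i j q) = (χ q : R) * e i j := by
  change ∑ k, ∑ l, (χ (Matrix.single i j q k l) : R) * e k l = _
  rw [Finset.sum_eq_single i, Finset.sum_eq_single j]
  · simp
  · intro l _ hl
    simp [Matrix.single_apply_of_col_ne _ _ hl.symm]
  · simp
  · intro k _ hk
    refine Finset.sum_eq_zero fun l _ => ?_
    simp [Matrix.single_apply_of_row_ne hk.symm]
  · simp

end MatrixHom

end IsMatrixUnits

section MatrixCorner

theorem matrix_single_injective {ι Q : Type*} [DecidableEq ι] [Zero Q] (i j : ι) :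
    Function.Injective (Matrix.single i j : Q → Matrix ι ι Q) := fun a b h => by
  simpa using congrFun (congrFun h i) j

variable {K ι Q Q' : Type*} [Field K] [Fintype ι] [DecidableEq ι] [Semiring Q] [Algebra K Q]
  [Semiring Q'] [Algebra K Q']

theorem matrix_single_eq_mul (i j : ι) (q : Q) :
    Matrix.single i j q = Matrix.scalar ι q * Matrix.single i j 1 := by
  ext k l
  simp [Matrix.single_apply, Matrix.scalar_apply, Matrix.diagonal_mul]

theorem matrix_algHom_ext {B : Type*} [Semiring B] [Algebra K B] {φ ψ : Matrix ι ι Q →ₐ[K] B}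
    (h : ∀ q, φ (Matrix.scalar ι q) = ψ (Matrix.scalar ι q))
    (h' : ∀ i j, φ (Matrix.single i j 1) = ψ (Matrix.single i j 1)) : φ = ψ := by
  refine AlgHom.ext fun M => ?_
  rw [Matrix.matrix_eq_sum_single M]
  simp only [map_sum, matrix_single_eq_mul _ _ (M _ _), map_mul, h, h']

/-- The restriction to a diagonal corner of a homomorphism of matrix rings that preserves
the elementary idempotent of that corner. -/
def cornerHom (Θ : Matrix ι ι Q →ₐ[K] Matrix ι ι Q') (r : ι)
    (hr : Θ (Matrix.single r r 1) = Matrix.single r r 1) : Q →ₐ[K] Q' :=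
  AlgHom.ofLinearMap
    { toFun := fun q => Θ (Matrix.single r r q) r r
      map_add' := fun a b => by simp [Matrix.single_add]
      map_smul' := fun c a => by
        rw [← Matrix.smul_single, map_smul]
        rfl }
    (by
      change Θ (Matrix.single r r 1) r r = 1
      rw [hr, Matrix.single_apply_same])
    (fun a b => by
      change Θ (Matrix.single r r (a * b)) r r =
        Θ (Matrix.single r r a) r r * Θ (Matrix.single r r b) r r
      have h : Matrix.single r r (a * b) =
          Matrix.single r r a * Matrix.single r r 1 * Matrix.single r r b := by simp
      rw [h, map_mul, map_mul, hr, Matrix.mul_apply, Finset.sum_eq_single r]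
      · simp
      · intro s _ hs
        simp [hs]
      · simp)

theorem single_cornerHom (Θ : Matrix ι ι Q →ₐ[K] Matrix ι ι Q') (r : ι)
    (hr : Θ (Matrix.single r r 1) = Matrix.single r r 1) (q : Q) :
    Matrix.single r r (cornerHom Θ r hr q) = Θ (Matrix.single r r q) := by
  have h : Matrix.single r r q =
      Matrix.single r r 1 * Matrix.single r r q * Matrix.single r r 1 := by simp
  rw [h, map_mul, map_mul, hr, Matrix.single_mul_mul_single]
  simp [cornerHom]

/-- Matrix rings of the same size are isomorphic over isomorphic coefficient rings if
an isomorphism preserves an elementary idempotent: the coefficient ring is the corner. -/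
theorem nonempty_algEquiv_of_matrix (Θ : Matrix ι ι Q ≃ₐ[K] Matrix ι ι Q') (r : ι)
    (hr : Θ (Matrix.single r r 1) = Matrix.single r r 1) : Nonempty (Q ≃ₐ[K] Q') := by
  have hr' : Θ.symm (Matrix.single r r 1) = Matrix.single r r 1 := by
    rw [AlgEquiv.symm_apply_eq, hr]
  let Φ : Matrix ι ι Q →ₐ[K] Matrix ι ι Q' := Θ
  let Ψ : Matrix ι ι Q' →ₐ[K] Matrix ι ι Q := Θ.symm
  have hΦ : Φ (Matrix.single r r 1) = Matrix.single r r 1 := hr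
  have hΨ : Ψ (Matrix.single r r 1) = Matrix.single r r 1 := hr'
  refine ⟨AlgEquiv.ofAlgHom (cornerHom Φ r hΦ) (cornerHom Ψ r hΨ) ?_ ?_⟩
  · refine AlgHom.ext fun q => matrix_single_injective r r ?_
    rw [AlgHom.comp_apply, single_cornerHom, single_cornerHom]
    exact Θ.apply_symm_apply _
  · refine AlgHom.ext fun q => matrix_single_injective r r ?_
    rw [AlgHom.comp_apply, single_cornerHom, single_cornerHom]
    exact Θ.symm_apply_apply _

end MatrixCorner

/-! ### The algebra of one edge -/

section EdgeAlgebra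

open FactorKind

variable {K : Type u} [Field K]

/-- The free product of `K[z, z⁻¹]` and `K[t] / (g)` is the algebra of one edge: `x` corresponds
to `z` and `x̄` to `z⁻¹ t`. -/
theorem nonempty_edgeAlgebra_algEquiv (g : K[X]) (h0 : g.coeff 0 ≠ 0) :
    Nonempty (EdgeAlgebra K g ≃ₐ[K] FactorProduct K ![.laurent, .root g]) := by
  let k : Fin 2 → FactorKind K := ![.laurent, .root g]
  let incl₀ : (laurent : FactorKind K).Carrier →ₐ[K] FactorProduct K k := FactorProduct.incl k 0
  let incl₁ : (root g).Carrier →ₐ[K] FactorProduct K k := FactorProduct.incl k 1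
  let z : (FactorProduct K k)ˣ := Units.map (MonoidHomClass.toMonoidHom incl₀) laurentGen
  let t : FactorProduct K k := incl₁ (rootGen g)
  have ht : aeval t g = 0 := by
    rw [aeval_algHom_apply, aeval_rootGen, map_zero]
  let s : Set (FreeAlgebra K (Fin 2)) :=
    {aeval (FreeAlgebra.ι K (0 : Fin 2) * FreeAlgebra.ι K (1 : Fin 2)) g,
      aeval (FreeAlgebra.ι K (1 : Fin 2) * FreeAlgebra.ι K (0 : Fin 2)) g}
  let π : FreeAlgebra K (Fin 2) →ₐ[K] EdgeAlgebra K g := RingCon.mkₐ K _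
  let x : EdgeAlgebra K g := π (FreeAlgebra.ι K 0)
  let x' : EdgeAlgebra K g := π (FreeAlgebra.ι K 1)
  have h1 : aeval (x * x') g = 0 := by
    have := TwoSidedIdeal.mk_eq_zero_of_mem (K := K) (s := s) (Set.mem_insert _ _)
    rw [← this, ← map_mul π]
    exact aeval_algHom_apply π _ g
  have h2 : aeval (x' * x) g = 0 := by
    have := TwoSidedIdeal.mk_eq_zero_of_mem (K := K) (s := s)
      (Set.mem_insert_of_mem _ (Set.mem_singleton _))
    rw [← this, ← map_mul π]
    exact aeval_algHom_apply π _ g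
  obtain ⟨ux, hux⟩ := isUnit_of_aeval_mul h0 h1 h2
  let φ₀ : FreeAlgebra K (Fin 2) →ₐ[K] FactorProduct K k :=
    FreeAlgebra.lift K ![(z : FactorProduct K k), (↑z⁻¹ : FactorProduct K k) * t]
  have hφ0 : φ₀ (FreeAlgebra.ι K 0) = z := by simp [φ₀]
  have hφ1 : φ₀ (FreeAlgebra.ι K 1) = ↑z⁻¹ * t := by simp [φ₀]
  let φ : EdgeAlgebra K g →ₐ[K] FactorProduct K k := TwoSidedIdeal.spanLift s φ₀ <| by
    rintro _ (rfl | rfl)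
    · rw [← aeval_algHom_apply, map_mul, hφ0, hφ1, Units.mul_inv_cancel_left, ht]
    · rw [← aeval_algHom_apply, map_mul, hφ0, hφ1]
      rw [aeval_units_conj, ht, mul_zero, zero_mul]
  have hφx : φ x = z := hφ0
  have hφx' : φ x' = ↑z⁻¹ * t := hφ1
  let ψ : FactorProduct K k →ₐ[K] EdgeAlgebra K g := FactorProduct.lift fun i =>
    match i with
    | 0 => laurentHom ux
    | 1 => rootHom (x * x') h1
  have hψz : ψ z = x := by
    rw [← hux]
    exact (FactorProduct.lift_incl _ 0 _).trans (laurentHom_laurentGen ux)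
  have hψt : ψ t = x * x' :=
    (FactorProduct.lift_incl _ 1 _).trans (rootHom_rootGen _ h1)
  have hψz' : ψ ↑z⁻¹ = ↑ux⁻¹ := map_inv_units_of_eq (hψz.trans hux.symm)
  refine ⟨AlgEquiv.ofAlgHom φ ψ ?_ ?_⟩
  · refine FactorProduct.hom_ext fun i => ?_
    fin_cases i
    · exact laurent_hom_ext (φ := (φ.comp ψ).comp incl₀) (ψ := incl₀) <| by
        change φ (ψ z) = z
        rw [hψz, hφx]
    · exact root_hom_ext (φ := (φ.comp ψ).comp incl₁) (ψ := incl₁) <| by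
        change φ (ψ t) = t
        rw [hψt, map_mul, hφx, hφx', Units.mul_inv_cancel_left]
  · refine RingCon.Quotient.hom_extₐ (FreeAlgebra.hom_ext (funext fun i => ?_))
    fin_cases i
    · change ψ (φ x) = x
      rw [hφx, hψz]
    · change ψ (φ x') = x'
      rw [hφx', map_mul, hψz', hψt, ← hux, Units.inv_mul_cancel_left]

end EdgeAlgebra

/-! ### Edge generators of the free product -/

namespace SerreGraph

open FactorKind

variable {K : Type u} [Field K] {S : Type v} {Y : Type w}

section

variable (Y₁ : Set Y) (f : Y → K[X]) (T P : Set Y)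

/-- The free product attached to a tree `T` and an orientation `P`. -/
abbrev EdgeProduct : Type (max u w) := FactorProduct K (factors Y₁ f T P)

/-- The embedding of the factor `K[t] / (f y)`. -/
noncomputable def inclRoot (y : ↥(Y₁ ∩ P)) : (root (f y)).Carrier →ₐ[K] EdgeProduct Y₁ f T P :=
  FactorProduct.incl (factors Y₁ f T P) (.inl y)

/-- The embedding of the factor `K[z, z⁻¹]` of an edge. -/
noncomputable def inclLaurent (y : ↥((Y₁ ∩ P) \ (T ∩ P))) :
    (laurent : FactorKind K).Carrier →ₐ[K] EdgeProduct Y₁ f T P :=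
  FactorProduct.incl (factors Y₁ f T P) (.inr (.inl y))

/-- The embedding of the free factor of an edge. -/
noncomputable def inclFree (y : ↥(P \ (Y₁ ∩ P))) :
    (free : FactorKind K).Carrier →ₐ[K] EdgeProduct Y₁ f T P :=
  FactorProduct.incl (factors Y₁ f T P) (.inr (.inr y))

variable {Y₁ f T P}

theorem edgeProduct_hom_ext_incl {B : Type*} [Semiring B] [Algebra K B]
    {φ ψ : EdgeProduct Y₁ f T P →ₐ[K] B}
    (h₁ : ∀ y, φ (inclRoot Y₁ f T P y (rootGen _)) = ψ (inclRoot Y₁ f T P y (rootGen _)))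
    (h₂ : ∀ y, φ (inclLaurent Y₁ f T P y (laurentGen (K := K))) =
      ψ (inclLaurent Y₁ f T P y (laurentGen (K := K))))
    (h₃ : ∀ y i, φ (inclFree Y₁ f T P y (freeGen i)) = ψ (inclFree Y₁ f T P y (freeGen i))) :
    φ = ψ := by
  refine FactorProduct.hom_ext fun i => ?_
  rcases i with y | y | y
  · exact root_hom_ext (φ := φ.comp (inclRoot Y₁ f T P y)) (ψ := ψ.comp (inclRoot Y₁ f T P y)) (h₁ y)
  · exact laurent_hom_ext (φ := φ.comp (inclLaurent Y₁ f T P y))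
      (ψ := ψ.comp (inclLaurent Y₁ f T P y)) (h₂ y)
  · exact free_hom_ext (φ := φ.comp (inclFree Y₁ f T P y))
      (ψ := ψ.comp (inclFree Y₁ f T P y)) (h₃ y)

theorem exists_edgeProduct_hom_incl {B : Type*} [Semiring B] [Algebra K B]
    (t : ↥(Y₁ ∩ P) → B) (ht : ∀ y, aeval (t y) (f y) = 0) (z : ↥((Y₁ ∩ P) \ (T ∩ P)) → Bˣ)
    (x : ↥(P \ (Y₁ ∩ P)) → Fin 2 → B) :
    ∃ φ : EdgeProduct Y₁ f T P →ₐ[K] B,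
      (∀ y, φ (inclRoot Y₁ f T P y (rootGen _)) = t y) ∧
      (∀ y, φ (inclLaurent Y₁ f T P y (laurentGen (K := K))) = z y) ∧
      ∀ y i, φ (inclFree Y₁ f T P y (freeGen i)) = x y i := by
  let φ : ∀ i, (factors Y₁ f T P i).Carrier →ₐ[K] B
    | .inl y => (rootHom (t y) (ht y) : (root (f y)).Carrier →ₐ[K] B)
    | .inr (.inl y) => (laurentHom (z y) : (laurent : FactorKind K).Carrier →ₐ[K] B)
    | .inr (.inr y) => (freeHom (x y) : (free : FactorKind K).Carrier →ₐ[K] B)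
  refine ⟨FactorProduct.lift φ, fun y => ?_, fun y => ?_, fun y i => ?_⟩
  · have h : ∀ a : (root (f y)).Carrier,
        FactorProduct.lift φ (inclRoot Y₁ f T P y a) = rootHom (t y) (ht y) a :=
      FactorProduct.lift_incl φ (.inl y)
    rw [h, rootHom_rootGen]
  · have h : ∀ a : (laurent : FactorKind K).Carrier,
        FactorProduct.lift φ (inclLaurent Y₁ f T P y a) = laurentHom (z y) a :=
      FactorProduct.lift_incl φ (.inr (.inl y))
    rw [h, laurentHom_laurentGen]
  · have h : ∀ a : (free : FactorKind K).Carrier,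
        FactorProduct.lift φ (inclFree Y₁ f T P y a) = freeHom (x y) a :=
      FactorProduct.lift_incl φ (.inr (.inr y))
    rw [h, freeHom_freeGen]

end

variable (Γ : SerreGraph S Y)

theorem IsOrientation.bar_mem_iff {Γ : SerreGraph S Y} {P : Set Y} (hP : Γ.IsOrientation P)
    (y : Y) : Γ.bar y ∈ P ↔ y ∉ P := by
  constructor
  · intro h h'
    exact Set.disjoint_left.1 hP.2 h ⟨y, h', rfl⟩
  · intro h
    rcases (hP.1 ▸ Set.mem_univ y : y ∈ P ∪ Γ.bar '' P) with h' | ⟨x, hx, rfl⟩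
    · exact absurd h' h
    · rwa [Γ.bar_bar]

open Classical in
theorem exists_isOrientation : ∃ P, Γ.IsOrientation P := by
  let : LinearOrder Y := linearOrderOfSTO WellOrderingRel
  refine ⟨{y | y < Γ.bar y}, Set.eq_univ_of_forall fun y => ?_, Set.disjoint_left.2 ?_⟩
  · rcases lt_trichotomy y (Γ.bar y) with h | h | h
    · exact Or.inl h
    · exact absurd h.symm (Γ.bar_ne y)
    · exact Or.inr ⟨Γ.bar y, by simpa [Γ.bar_bar] using h, Γ.bar_bar y⟩
  · rintro _ h ⟨y, h', rfl⟩
    rw [Set.mem_ofPred_eq, Γ.bar_bar] at h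
    exact lt_asymm h h'

theorem PropertyF.bar_mem_iff {Γ : SerreGraph S Y} {Y₁ : Set Y} {f : Y → K[X]}
    (hF : Γ.PropertyF Y₁ f) (y : Y) : Γ.bar y ∈ Y₁ ↔ y ∈ Y₁ := by
  have : ∀ y ∈ Y₁, Γ.bar y ∈ Y₁ := fun y hy => hF.bar_image ▸ ⟨y, hy, rfl⟩
  exact ⟨fun h => Γ.bar_bar y ▸ this _ h, this y⟩

variable {Γ} (Y₁ : Set Y) (f : Y → K[X]) (T : Set Y) {P : Set Y}

open Classical in
/-- The element of the free product attached to an edge `y` of the orientation: `1` on the tree,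
`z_y` on the other edges in `Y₁`, and `x_y` outside `Y₁`. -/
noncomputable def forwardGen (y : Y) (hy : y ∈ P) : EdgeProduct Y₁ f T P :=
  if h₁ : y ∈ Y₁ then
    if hT : y ∈ T then 1
    else inclLaurent Y₁ f T P ⟨y, ⟨h₁, hy⟩, fun h => hT h.1⟩ (laurentGen (K := K))
  else inclFree Y₁ f T P ⟨y, hy, fun h => h₁ h.1⟩ (freeGen 0)

open Classical in
/-- The element of the free product attached to the inverse of an edge `y` of the orientation:
`t_y` on the tree, `z_y⁻¹ t_y` on the other edges in `Y₁`, and `x̄_y` outside `Y₁`. The product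
along `y ȳ` is thus `t_y` if `y ∈ Y₁`. -/
noncomputable def backwardGen (y : Y) (hy : y ∈ P) : EdgeProduct Y₁ f T P :=
  if h₁ : y ∈ Y₁ then
    if hT : y ∈ T then inclRoot Y₁ f T P ⟨y, h₁, hy⟩ (rootGen (f y))
    else
      inclLaurent Y₁ f T P ⟨y, ⟨h₁, hy⟩, fun h => hT h.1⟩
          ((laurentGen (K := K))⁻¹ : (laurent : FactorKind K).Carrierˣ) *
        inclRoot Y₁ f T P ⟨y, h₁, hy⟩ (rootGen (f y))
  else inclFree Y₁ f T P ⟨y, hy, fun h => h₁ h.1⟩ (freeGen 1)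

open Classical in
/-- The element of the free product attached to an edge. -/
noncomputable def edgeGen (hP : Γ.IsOrientation P) (y : Y) : EdgeProduct Y₁ f T P :=
  if hy : y ∈ P then forwardGen Y₁ f T y hy
  else backwardGen Y₁ f T (Γ.bar y) ((hP.bar_mem_iff y).2 hy)

variable {Y₁ f T}

theorem edgeGen_of_mem (hP : Γ.IsOrientation P) {y : Y} (hy : y ∈ P) :
    edgeGen Y₁ f T hP y = forwardGen Y₁ f T y hy := dif_pos hy

theorem edgeGen_bar_of_mem (hP : Γ.IsOrientation P) {y : Y} (hy : y ∈ P) :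
    edgeGen Y₁ f T hP (Γ.bar y) = backwardGen Y₁ f T y hy := by
  have : ∀ x (hx : x ∈ P), x = y → backwardGen Y₁ f T x hx = backwardGen Y₁ f T y hy := by
    rintro _ _ rfl
    rfl
  rw [edgeGen, dif_neg fun h => (hP.bar_mem_iff y).1 h hy, this _ _ (Γ.bar_bar y)]

theorem edgeGen_of_mem_tree (hP : Γ.IsOrientation P) {y : Y} (hy : y ∈ P) (h₁ : y ∈ Y₁)
    (hT : y ∈ T) : edgeGen Y₁ f T hP y = 1 := by
  rw [edgeGen_of_mem hP hy, forwardGen, dif_pos h₁, dif_pos hT]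

theorem inclLaurent_mul_inv (y : ↥((Y₁ ∩ P) \ (T ∩ P))) :
    inclLaurent Y₁ f T P y (laurentGen (K := K)) *
      inclLaurent Y₁ f T P y ((laurentGen (K := K))⁻¹ : (laurent : FactorKind K).Carrierˣ) = 1 := by
  rw [← map_mul, Units.mul_inv, map_one]

theorem forwardGen_mul_backwardGen {y : Y} (hy : y ∈ P) (h₁ : y ∈ Y₁) :
    forwardGen Y₁ f T y hy * backwardGen Y₁ f T y hy =
      inclRoot Y₁ f T P ⟨y, h₁, hy⟩ (rootGen (f y)) := by
  by_cases hT : y ∈ T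
  · rw [forwardGen, backwardGen, dif_pos h₁, dif_pos h₁, dif_pos hT, dif_pos hT, one_mul]
  · rw [forwardGen, backwardGen, dif_pos h₁, dif_pos h₁, dif_neg hT, dif_neg hT, ← mul_assoc,
      inclLaurent_mul_inv, one_mul]

theorem aeval_inclRoot (y : ↥(Y₁ ∩ P)) :
    aeval (inclRoot Y₁ f T P y (rootGen (f y))) (f y) = 0 := by
  rw [aeval_algHom_apply, aeval_rootGen, map_zero]

theorem isUnit_forwardGen {y : Y} (hy : y ∈ P) (h₁ : y ∈ Y₁) :
    IsUnit (forwardGen Y₁ f T y hy) := by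
  rw [forwardGen, dif_pos h₁]
  split_ifs
  · exact isUnit_one
  · exact (Units.isUnit _).map (inclLaurent Y₁ f T P _)

theorem aeval_edgeGen (hF : Γ.PropertyF Y₁ f) (hP : Γ.IsOrientation P) {y : Y} (h₁ : y ∈ Y₁) :
    aeval (edgeGen Y₁ f T hP y * edgeGen Y₁ f T hP (Γ.bar y)) (f y) = 0 := by
  by_cases hy : y ∈ P
  · rw [edgeGen_of_mem hP hy, edgeGen_bar_of_mem hP hy, forwardGen_mul_backwardGen hy h₁,
      aeval_inclRoot ⟨y, h₁, hy⟩]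
  · have hy' := (hP.bar_mem_iff y).2 hy
    have h₁' := (hF.bar_mem_iff y).2 h₁
    obtain ⟨u, hu⟩ := isUnit_forwardGen (K := K) (f := f) (T := T) hy' h₁'
    -- with `u` the generator of `ȳ` and `t` that of the root, the product along `y ȳ` is `u⁻¹ t u`
    have hb : edgeGen Y₁ f T hP y = backwardGen Y₁ f T (Γ.bar y) hy' := dif_neg hy
    have ht := forwardGen_mul_backwardGen (K := K) (f := f) (T := T) hy' h₁'
    rw [← hu, ← Units.eq_inv_mul_iff_mul_eq] at ht
    rw [hb, edgeGen_of_mem hP hy', ht, ← hu, aeval_units_conj, hF.bar_eq y h₁,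
      aeval_inclRoot ⟨Γ.bar y, h₁', hy'⟩, mul_zero, zero_mul]

theorem edgeProduct_hom_ext {B : Type*} [Semiring B] [Algebra K B] (hP : Γ.IsOrientation P)
    {φ ψ : EdgeProduct Y₁ f T P →ₐ[K] B}
    (h : ∀ y, φ (edgeGen Y₁ f T hP y) = ψ (edgeGen Y₁ f T hP y)) : φ = ψ := by
  refine edgeProduct_hom_ext_incl (fun y => ?_) (fun y => ?_) (fun y i => ?_)
  · obtain ⟨y, h₁, hy⟩ := y
    rw [← forwardGen_mul_backwardGen hy h₁, ← edgeGen_of_mem hP hy, ← edgeGen_bar_of_mem hP hy,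
      map_mul, map_mul, h, h]
  · obtain ⟨y, ⟨h₁, hy⟩, hT⟩ := y
    have := h y
    rwa [edgeGen_of_mem hP hy, forwardGen, dif_pos h₁, dif_neg fun h => hT ⟨h, hy⟩] at this
  · obtain ⟨y, hy, h₁⟩ := y
    have h₁' : y ∉ Y₁ := fun h => h₁ ⟨h, hy⟩
    have h0 := h y
    have h1 := h (Γ.bar y)
    rw [edgeGen_of_mem hP hy, forwardGen, dif_neg h₁'] at h0
    rw [edgeGen_bar_of_mem hP hy, backwardGen, dif_neg h₁'] at h1
    fin_cases i
    exacts [h0, h1]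

/-- The universal property of the free product in terms of the generators attached to the edges:
the relations `f_y (y ȳ) = 0` for `y ∈ Y₁` and `y = 1` on the oriented tree edges imply all others.
The invertibility of `z_y` follows from the first relation for `y` and for `ȳ`. -/
theorem exists_edgeProduct_hom {B : Type*} [Ring B] [Algebra K B] (hF : Γ.PropertyF Y₁ f)
    (hP : Γ.IsOrientation P) (b : Y → B)
    (hb : ∀ y ∈ Y₁, aeval (b y * b (Γ.bar y)) (f y) = 0) (hT : ∀ y ∈ T, y ∈ P → b y = 1) :
    ∃ φ : EdgeProduct Y₁ f T P →ₐ[K] B, ∀ y, φ (edgeGen Y₁ f T hP y) = b y := by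
  have hu : ∀ y ∈ Y₁, IsUnit (b y) := fun y hy => by
    refine isUnit_of_aeval_mul (hF.isUnit_coeff_zero y hy).ne_zero (hb y hy) ?_
    have := hb _ ((hF.bar_mem_iff y).2 hy)
    rwa [Γ.bar_bar, ← hF.bar_eq y hy] at this
  obtain ⟨φ, h1, h2, h3⟩ := exists_edgeProduct_hom_incl (T := T)
    (fun y : ↥(Y₁ ∩ P) => b y * b (Γ.bar y)) (fun y => hb y y.2.1)
    (fun y => (hu y y.2.1.1).unit) (fun y => ![b y, b (Γ.bar y)])
  have key : ∀ y (hy : y ∈ P),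
      φ (forwardGen Y₁ f T y hy) = b y ∧ φ (backwardGen Y₁ f T y hy) = b (Γ.bar y) := by
    intro y hy
    by_cases h₁ : y ∈ Y₁
    · have hf : φ (forwardGen Y₁ f T y hy) = b y := by
        by_cases hyT : y ∈ T
        · rw [forwardGen, dif_pos h₁, dif_pos hyT, map_one, hT y hyT hy]
        · rw [forwardGen, dif_pos h₁, dif_neg hyT, h2]
          rfl
      refine ⟨hf, (hu y h₁).mul_left_cancel ?_⟩
      conv_lhs => rw [← hf]
      rw [← map_mul, forwardGen_mul_backwardGen hy h₁, h1]
    · constructor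
      · rw [forwardGen, dif_neg h₁, h3]
        rfl
      · rw [backwardGen, dif_neg h₁, h3]
        rfl
  refine ⟨φ, fun y => ?_⟩
  by_cases hy : y ∈ P
  · rw [edgeGen_of_mem hP hy, (key y hy).1]
  · rw [edgeGen, dif_neg hy, (key _ _).2, Γ.bar_bar]

end SerreGraph

/-! ### Transport along the tree -/

namespace SerreGraph

variable {S : Type v} {Y : Type w} {Γ : SerreGraph S Y}

/-- The product of the elements `v s` and `g y` along a list of edges that is traversed from `s`. -/
def transport {R : Type*} [Mul R] (Γ : SerreGraph S Y) (v : S → R) (g : Y → R) : S → List Y → R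
  | s, [] => v s
  | _, y :: l => g y * transport Γ v g (Γ.t y) l

/-- The vertices are represented by idempotents and the edges in `T` by elements of
the corresponding corners. -/
structure IsRepresentation {R : Type*} [Semiring R] (Γ : SerreGraph S Y) (T : Set Y) (v : S → R)
    (g : Y → R) : Prop where
  idem : ∀ s, v s * v s = v s
  left : ∀ y ∈ T, v (Γ.o y) * g y = g y
  right : ∀ y ∈ T, g y * v (Γ.t y) = g y

/-- A representation in which inverse edges in `T` are represented by inverse isomorphisms of
the idempotents. -/
structure IsTransport {R : Type*} [Semiring R] (Γ : SerreGraph S Y) (T : Set Y) (v : S → R)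
    (g : Y → R) : Prop extends IsRepresentation Γ T v g where
  mul_bar : ∀ y ∈ T, g y * g (Γ.bar y) = v (Γ.o y)

theorem o_bar (y : Y) : Γ.o (Γ.bar y) = Γ.t y := by rw [Γ.o_eq, Γ.bar_bar]

theorem t_bar (y : Y) : Γ.t (Γ.bar y) = Γ.o y := (Γ.o_eq y).symm

section

variable {R : Type*} [Semiring R] {T : Set Y} {v : S → R} {g : Y → R}

namespace IsRepresentation

theorem left_transport (h : Γ.IsRepresentation T v g) {s : S} {l : List Y} (hl : Γ.IsWalkFrom s l)
    (hT : ∀ y ∈ l, y ∈ T) : v s * transport Γ v g s l = transport Γ v g s l := by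
  cases l with
  | nil => exact h.idem s
  | cons y l =>
    obtain ⟨rfl, -⟩ := hl
    rw [transport, ← mul_assoc, h.left y (hT y (by simp))]

theorem transport_append (h : Γ.IsRepresentation T v g) {s : S} {l m : List Y}
    (hl : Γ.IsWalkFrom s (l ++ m)) (hT : ∀ y ∈ l ++ m, y ∈ T) :
    transport Γ v g s (l ++ m) = transport Γ v g s l * transport Γ v g (Γ.endVertex s l) m := by
  induction l generalizing s with
  | nil => exact (h.left_transport hl hT).symm
  | cons y l ih =>
    rw [List.cons_append, transport, ih hl.2 fun z hz => hT z (List.mem_cons_of_mem _ hz),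
      transport, mul_assoc, endVertex]

theorem transport_right (h : Γ.IsRepresentation T v g) {s : S} {l : List Y}
    (hT : ∀ y ∈ l, y ∈ T) :
    transport Γ v g s l * v (Γ.endVertex s l) = transport Γ v g s l := by
  induction l generalizing s with
  | nil => exact h.idem s
  | cons y l ih =>
    rw [transport, endVertex, mul_assoc, ih fun z hz => hT z (List.mem_cons_of_mem _ hz)]

end IsRepresentation

namespace IsTransport

/-- Transport along a closed path in a tree is trivial, since the path has backtracking, which
can be removed without changing the transport. -/
theorem transport_closed (h : Γ.IsTransport T v g) (tree : Γ.IsSpanningTree T) (n : ℕ) :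
    ∀ (s : S) (l : List Y), l.length ≤ n → Γ.IsWalkFrom s l → (∀ y ∈ l, y ∈ T) →
      Γ.endVertex s l = s → transport Γ v g s l = v s := by
  induction n with
  | zero =>
    intro s l hn _ _ _
    rw [List.length_eq_zero_iff.1 (Nat.le_zero.1 hn)]
    rfl
  | succ n ih =>
    intro s l hn hl hT hend
    by_cases hnil : l = []
    · rw [hnil]
      rfl
    have hchain : ¬ l.IsChain (fun y z => z ≠ Γ.bar y) := fun hc =>
      tree.no_circuit ⟨s, l, hl⟩ hT ⟨hnil, hend.symm, hc⟩
    rw [List.isChain_iff_forall_rel_of_append_cons_cons] at hchain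
    push Not at hchain
    obtain ⟨y, z, l₁, l₂, rfl, rfl⟩ := hchain
    have hy : y ∈ T := hT y (by simp)
    have hw := isWalkFrom_append.1 hl
    obtain ⟨ho, -, hw₂⟩ := hw.2
    rw [t_bar, ho] at hw₂
    have hw' : Γ.IsWalkFrom s (l₁ ++ l₂) := isWalkFrom_append.2 ⟨hw.1, hw₂⟩
    have hT' : ∀ x ∈ l₁ ++ l₂, x ∈ T := fun x hx => hT x <| by
      rcases List.mem_append.1 hx with hx | hx <;> simp [hx]
    have hT₂ : ∀ x ∈ l₂, x ∈ T := fun x hx => hT' x (List.mem_append_right _ hx)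
    have hend' : Γ.endVertex s (l₁ ++ l₂) = s := by
      rw [endVertex_append, endVertex, endVertex, t_bar, ho, ← endVertex_append] at hend
      exact hend
    rw [← ih s (l₁ ++ l₂) (by simp at hn ⊢; omega) hw' hT' hend', h.transport_append hl hT,
      h.transport_append hw' hT', transport, transport, ← mul_assoc (g y), h.mul_bar y hy, t_bar,
      ho, h.left_transport hw₂ hT₂]

/-- Transport in a tree depends only on the endpoints of the path. -/
theorem transport_eq (h : Γ.IsTransport T v g) (tree : Γ.IsSpanningTree T) {p q : Γ.Path}
    (hp : ∀ y ∈ p.edges, y ∈ T) (hq : ∀ y ∈ q.edges, y ∈ T) (hs : p.src = q.src)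
    (ht : p.tgt = q.tgt) :
    transport Γ v g p.src p.edges = transport Γ v g q.src q.edges := by
  obtain ⟨r, hr, hr', hrT⟩ := tree.connected p.tgt p.src
  have closed : ∀ a b : Γ.Path, (∀ y ∈ a.edges, y ∈ T) → (∀ y ∈ b.edges, y ∈ T) →
      a.tgt = b.src → b.tgt = a.src →
      transport Γ v g a.src a.edges * transport Γ v g b.src b.edges = v a.src := by
    intro a b ha hb hab hba
    have hT : ∀ y ∈ (a.comp b hab).edges, y ∈ T := fun y hy =>
      (List.mem_append.1 hy).elim (ha y) (hb y)
    have := h.transport_closed tree _ _ _ le_rfl (a.comp b hab).isWalk hT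
      ((Path.tgt_comp a b hab).trans hba)
    rw [← hab]
    exact (h.transport_append (a.comp b hab).isWalk hT).symm.trans this
  have hpr := closed p r hp hrT hr.symm hr'
  have hrq := closed r q hrT hq (hr'.trans hs) (ht.symm.trans hr.symm)
  have hrp := closed r p hrT hp hr' hr.symm
  calc
    _ = v p.src * transport Γ v g p.src p.edges := (h.left_transport p.isWalk hp).symm
    _ = transport Γ v g p.src p.edges *
        (transport Γ v g r.src r.edges * transport Γ v g p.src p.edges) := by
      rw [← hpr, mul_assoc]
    _ = v q.src * transport Γ v g q.src q.edges := by rw [hrp, ← hrq, ← mul_assoc, hpr, hs]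
    _ = _ := h.left_transport q.isWalk hq

/-- The transports between the vertices along a tree form a system of matrix units. -/
theorem exists_isMatrixUnits [Fintype S] (h : Γ.IsTransport T v g) (tree : Γ.IsSpanningTree T)
    (hv : ∀ s t, s ≠ t → v s * v t = 0) (hv1 : ∑ s, v s = 1) :
    ∃ e : S → S → R, IsMatrixUnits e ∧
      ∀ p : Γ.Path, (∀ y ∈ p.edges, y ∈ T) → transport Γ v g p.src p.edges = e p.src p.tgt := by
  choose p hps hpt hpT using tree.connected
  let e : S → S → R := fun i j => transport Γ v g (p i j).src (p i j).edges
  have he : ∀ q : Γ.Path, (∀ y ∈ q.edges, y ∈ T) →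
      transport Γ v g q.src q.edges = e q.src q.tgt := fun q hq =>
    h.transport_eq tree hq (hpT _ _) (hps _ _).symm (hpt _ _).symm
  have hmul : ∀ i j k, e i j * e j k = e i k := fun i j k => by
    have hjk : (p i j).tgt = (p j k).src := (hpt i j).trans (hps j k).symm
    have hT : ∀ y ∈ ((p i j).comp (p j k) hjk).edges, y ∈ T := fun y hy =>
      (List.mem_append.1 hy).elim (hpT _ _ y) (hpT _ _ y)
    have := he _ hT
    rw [Path.tgt_comp, hpt] at this
    have hi : ((p i j).comp (p j k) hjk).src = i := hps i j
    refine Eq.trans ?_ (this.trans (congrArg (e · k) hi))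
    refine Eq.trans ?_ (h.transport_append ((p i j).comp (p j k) hjk).isWalk hT).symm
    change _ * transport Γ v g _ _ = _ * transport Γ v g (p i j).tgt _
    rw [hjk]
    rfl
  have hdiag : ∀ i, e i i = v i := fun i => (he (Path.nil Γ i) (by simp [Path.nil])).symm
  refine ⟨e, ⟨hmul, fun i j k l hjk => ?_, ?_⟩, he⟩
  · rw [← hmul i j j, ← hmul k k l, hdiag, hdiag, mul_assoc, ← mul_assoc (v j), hv j k hjk,
      zero_mul, mul_zero]
  · simp only [hdiag, hv1]

end IsTransport

end

end SerreGraph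

/-! ### Homomorphisms out of the path algebra -/

namespace SerreGraph

variable {K : Type u} [Field K] {S : Type v} {Y : Type w} {Γ : SerreGraph S Y}

namespace PathAlgebra

theorem vertex_mul_ofPath (p : Γ.Path) : vertex Γ K p.src * ofPath K p = ofPath K p := by
  rw [vertex, ofPath_mul_ofPath, pathMul, dif_pos (show (Path.nil Γ p.src).tgt = p.src from rfl)]
  rfl

theorem ofPath_mul_vertex (p : Γ.Path) : ofPath K p * vertex Γ K p.tgt = ofPath K p := by
  rw [vertex, ofPath_mul_ofPath, pathMul, dif_pos (show p.tgt = (Path.nil Γ p.tgt).src from rfl)]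
  congr 1
  ext1
  · rfl
  · simp [Path.comp, Path.nil]

theorem vertex_mul_vertex_of_ne {s t : S} (h : s ≠ t) : vertex Γ K s * vertex Γ K t = 0 := by
  rw [vertex, vertex, ofPath_mul_ofPath, pathMul, dif_neg]
  exact h

theorem isRepresentation [Fintype S] (T : Set Y) :
    Γ.IsRepresentation T (vertex Γ K) (edge Γ K) where
  idem s := vertex_mul_ofPath (Path.nil Γ s)
  left y _ := vertex_mul_ofPath (Path.ofEdge Γ y)
  right y _ := ofPath_mul_vertex (Path.ofEdge Γ y)

theorem ofPath_cons (s : S) (y : Y) (l : List Y) (h : Γ.IsWalkFrom s (y :: l)) :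
    ofPath K (⟨s, y :: l, h⟩ : Γ.Path) = edge Γ K y * ofPath K (⟨Γ.t y, l, h.2⟩ : Γ.Path) := by
  rw [edge, ofPath_mul_ofPath, pathMul, dif_pos (show (Path.ofEdge Γ y).tgt = Γ.t y from rfl)]
  congr 1
  ext1
  · exact h.1.symm
  · rfl

theorem evalAt_eq [Fintype S] (f : K[X]) (y : Y) : evalAt Γ f y =
    vertex Γ K (Γ.o y) * aeval (edge Γ K y * edge Γ K (Γ.bar y)) f := by
  rw [evalAt, aeval_def, eval₂_eq_sum, Polynomial.sum, Polynomial.sum, Finset.mul_sum]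
  simp only [← Algebra.smul_def, mul_smul_comm]

section Hom

variable [Fintype S] {B : Type*} [Semiring B] [Algebra K B]

theorem algHom_ext {φ ψ : PathAlgebra K Γ →ₐ[K] B}
    (hv : ∀ s, φ (vertex Γ K s) = ψ (vertex Γ K s)) (he : ∀ y, φ (edge Γ K y) = ψ (edge Γ K y)) :
    φ = ψ := by
  have key : ∀ (l : List Y) (s : S) (h : Γ.IsWalkFrom s l),
      φ (ofPath K ⟨s, l, h⟩) = ψ (ofPath K ⟨s, l, h⟩) := by
    intro l
    induction l with
    | nil => exact fun s _ => hv s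
    | cons y l ih =>
      intro s h
      rw [ofPath_cons, map_mul, map_mul, he, ih]
  have : φ.toLinearMap = ψ.toLinearMap := hom_ext K fun p => key p.edges p.src p.isWalk
  exact AlgHom.ext fun x => LinearMap.congr_fun this x

/-- The homomorphism out of the path algebra that is given by the images of the vertices and
of the edges. -/
noncomputable def lift (v : S → B) (g : Y → B) (h : Γ.IsRepresentation Set.univ v g)
    (hv : ∀ s t, s ≠ t → v s * v t = 0) (hv1 : ∑ s, v s = 1) : PathAlgebra K Γ →ₐ[K] B :=
  let L : PathAlgebra K Γ →ₗ[K] B := liftLin K fun p => transport Γ v g p.src p.edges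
  AlgHom.ofLinearMap L
    (by
      rw [one_eq, map_sum, ← hv1]
      exact Finset.sum_congr rfl fun s _ => liftLin_ofPath K _ (Path.nil Γ s))
    (fun a b => by
      have : LinearMap.compr₂ (mulLin K) L = LinearMap.compl₁₂ (LinearMap.mul K B) L L := by
        refine hom_ext K fun p => hom_ext K fun q => ?_
        rw [LinearMap.compr₂_apply, LinearMap.compl₁₂_apply, ← mul_eq, ofPath_mul_ofPath, pathMul,
          LinearMap.mul_apply', liftLin_ofPath, liftLin_ofPath]
        by_cases hpq : p.tgt = q.src
        · rw [dif_pos hpq, liftLin_ofPath]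
          refine (h.transport_append (p.comp q hpq).isWalk fun _ _ => trivial).trans ?_
          change _ * transport Γ v g p.tgt _ = _
          rw [hpq]
          rfl
        · rw [dif_neg hpq, map_zero, ← h.transport_right (fun _ _ => trivial),
            ← h.left_transport q.isWalk (fun _ _ => trivial), mul_assoc, ← mul_assoc (v _)]
          have := hv p.tgt q.src hpq
          rw [Path.tgt] at this
          rw [this, zero_mul, mul_zero]
      exact LinearMap.congr_fun (LinearMap.congr_fun this a) b)

variable {v : S → B} {g : Y → B} (h : Γ.IsRepresentation Set.univ v g)
  (hv : ∀ s t, s ≠ t → v s * v t = 0) (hv1 : ∑ s, v s = 1)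

theorem lift_vertex (s : S) : lift (K := K) v g h hv hv1 (vertex Γ K s) = v s :=
  liftLin_ofPath K _ _

theorem lift_edge (y : Y) : lift (K := K) v g h hv hv1 (edge Γ K y) = g y :=
  (liftLin_ofPath K _ _).trans (h.right y trivial)

end Hom

end PathAlgebra

end SerreGraph

/-! ### The quotient of the path algebra as a matrix ring -/

namespace SerreGraph

variable {K : Type u} [Field K] {S : Type v} {Y : Type w} [Fintype S] {Γ : SerreGraph S Y}
  {Y₁ : Set Y} {f : Y → K[X]} {T P : Set Y}

variable (Γ Y₁ f) in
/-- The class of a vertex. -/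
noncomputable def quotVertex (s : S) : Γ.RelationQuotient Y₁ f :=
  (Γ.relationIdeal Y₁ f).ringCon.mkₐ K (PathAlgebra.vertex Γ K s)

variable (Γ Y₁ f) in
/-- The class of an edge. -/
noncomputable def quotEdge (y : Y) : Γ.RelationQuotient Y₁ f :=
  (Γ.relationIdeal Y₁ f).ringCon.mkₐ K (PathAlgebra.edge Γ K y)

theorem quot_isRepresentation (T : Set Y) :
    Γ.IsRepresentation T (quotVertex Γ Y₁ f) (quotEdge Γ Y₁ f) where
  idem s := by
    rw [quotVertex, ← map_mul, (PathAlgebra.isRepresentation T).idem]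
  left y hy := by
    rw [quotVertex, quotEdge, ← map_mul, (PathAlgebra.isRepresentation T).left y hy]
  right y hy := by
    rw [quotVertex, quotEdge, ← map_mul, (PathAlgebra.isRepresentation T).right y hy]

theorem quotVertex_mul_of_ne {s t : S} (h : s ≠ t) :
    quotVertex Γ Y₁ f s * quotVertex Γ Y₁ f t = 0 := by
  rw [quotVertex, quotVertex, ← map_mul, PathAlgebra.vertex_mul_vertex_of_ne h, map_zero]

theorem sum_quotVertex : ∑ s, quotVertex Γ Y₁ f s = 1 := by
  simp only [quotVertex]
  rw [← map_sum]
  exact map_one _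

theorem quot_relation {y : Y} (hy : y ∈ Y₁) : quotVertex Γ Y₁ f (Γ.o y) *
    aeval (quotEdge Γ Y₁ f y * quotEdge Γ Y₁ f (Γ.bar y)) (f y) = 0 := by
  rw [quotEdge, quotEdge, ← map_mul, aeval_algHom_apply, quotVertex, ← map_mul,
    ← PathAlgebra.evalAt_eq]
  exact TwoSidedIdeal.mk_eq_zero_of_mem ⟨y, hy, rfl⟩

/-- The edges of the tree become isomorphisms of the vertex idempotents, which are represented by
the edges themselves for the edges of the orientation and by their inverses for the others. -/
theorem exists_quot_isTransport (hF : Γ.PropertyF Y₁ f) (hP : Γ.IsOrientation P)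
    (hT : ∀ y ∈ T, Γ.bar y ∈ T) (hT₁ : T ⊆ Y₁) :
    ∃ g, Γ.IsTransport T (quotVertex Γ Y₁ f) g ∧ ∀ y ∈ P, g y = quotEdge Γ Y₁ f y := by
  classical
  have rep := quot_isRepresentation (Γ := Γ) (Y₁ := Y₁) (f := f) Set.univ
  have hinv : ∀ y ∈ T, ∃ c, quotVertex Γ Y₁ f (Γ.t y) * c = c ∧
      c * quotVertex Γ Y₁ f (Γ.o y) = c ∧ quotEdge Γ Y₁ f y * c = quotVertex Γ Y₁ f (Γ.o y) ∧
      c * quotEdge Γ Y₁ f y = quotVertex Γ Y₁ f (Γ.t y) := fun y hy => by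
    have h2 := quot_relation (Γ := Γ) (f := f) (hT₁ (hT y hy))
    rw [Γ.bar_bar, o_bar, ← hF.bar_eq y (hT₁ hy)] at h2
    have hl := rep.left (Γ.bar y) trivial
    have hr := rep.right (Γ.bar y) trivial
    rw [o_bar] at hl
    rw [t_bar] at hr
    exact exists_inverse_of_aeval_mul (hF.isUnit_coeff_zero y (hT₁ hy)).ne_zero (rep.idem _)
      (rep.left y trivial) hl hr (quot_relation (hT₁ hy)) h2
  choose! c hc₁ hc₂ hc₃ hc₄ using hinv
  let g : Y → Γ.RelationQuotient Y₁ f := fun y => if y ∈ P then quotEdge Γ Y₁ f y else c (Γ.bar y)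
  have hg : ∀ y ∈ P, g y = quotEdge Γ Y₁ f y := fun y hy => if_pos hy
  have hg' : ∀ y, y ∉ P → g y = c (Γ.bar y) := fun y hy => if_neg hy
  refine ⟨g, ⟨⟨rep.idem, fun y hy => ?_, fun y hy => ?_⟩, fun y hy => ?_⟩, hg⟩
  · by_cases h : y ∈ P
    · rw [hg y h, rep.left y trivial]
    · rw [hg' y h, ← t_bar, hc₁ _ (hT y hy)]
  · by_cases h : y ∈ P
    · rw [hg y h, rep.right y trivial]
    · rw [hg' y h, ← o_bar, hc₂ _ (hT y hy)]
  · by_cases h : y ∈ P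
    · rw [hg y h, hg' _ fun h' => (hP.bar_mem_iff y).1 h' h, Γ.bar_bar, hc₃ y hy]
    · rw [hg' y h, hg _ ((hP.bar_mem_iff y).2 h), hc₄ _ (hT y hy), t_bar]

section ToMatrix

variable [DecidableEq S]

theorem single_isRepresentation {Q : Type*} [Semiring Q] (q : Y → Q) (T : Set Y) :
    Γ.IsRepresentation T (fun s => (Matrix.single s s 1 : Matrix S S Q))
      (fun y => Matrix.single (Γ.o y) (Γ.t y) (q y)) where
  idem s := by simp
  left y _ := by simp
  right y _ := by simp

variable (Y₁ f T) in
/-- The homomorphism of the path algebra to the matrix ring that sends an edge from `i` to `j` to the elementary matrix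
with entry `edgeGen` in the position `(i, j)`. -/
noncomputable def pathToMatrix (hP : Γ.IsOrientation P) :
    PathAlgebra K Γ →ₐ[K] Matrix S S (EdgeProduct Y₁ f T P) :=
  PathAlgebra.lift (fun s => Matrix.single s s 1)
    (fun y => Matrix.single (Γ.o y) (Γ.t y) (edgeGen Y₁ f T hP y))
    (single_isRepresentation _ _) (fun s t h => by simp [h]) Matrix.sum_single_one

theorem pathToMatrix_vertex (hP : Γ.IsOrientation P) (s : S) :
    pathToMatrix Y₁ f T hP (PathAlgebra.vertex Γ K s) = Matrix.single s s 1 :=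
  PathAlgebra.lift_vertex (single_isRepresentation _ _) (fun s t h => by simp [h])
    Matrix.sum_single_one s

theorem pathToMatrix_edge (hP : Γ.IsOrientation P) (y : Y) :
    pathToMatrix Y₁ f T hP (PathAlgebra.edge Γ K y) =
      Matrix.single (Γ.o y) (Γ.t y) (edgeGen Y₁ f T hP y) :=
  PathAlgebra.lift_edge (single_isRepresentation _ _) (fun s t h => by simp [h])
    Matrix.sum_single_one y

/-- The homomorphism `pathToMatrix` on the quotient by the relations. -/
noncomputable def toMatrix (hF : Γ.PropertyF Y₁ f) (hP : Γ.IsOrientation P) :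
    Γ.RelationQuotient Y₁ f →ₐ[K] Matrix S S (EdgeProduct Y₁ f T P) :=
  TwoSidedIdeal.spanLift _ (pathToMatrix Y₁ f T hP) <| by
      rintro _ ⟨y, hy, rfl⟩
      have hpow : ∀ n : ℕ, Matrix.single (Γ.o y) (Γ.o y) (1 : EdgeProduct Y₁ f T P) *
          Matrix.single (Γ.o y) (Γ.o y)
            (edgeGen Y₁ f T hP y * edgeGen Y₁ f T hP (Γ.bar y)) ^ n =
          Matrix.single (Γ.o y) (Γ.o y)
            ((edgeGen Y₁ f T hP y * edgeGen Y₁ f T hP (Γ.bar y)) ^ n) := fun n => by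
        induction n with
        | zero => simp
        | succ n ih =>
          rw [pow_succ, ← mul_assoc, ih, Matrix.single_mul_single_same, ← pow_succ]
      rw [PathAlgebra.evalAt_eq, map_mul, pathToMatrix_vertex, ← aeval_algHom_apply, map_mul,
        pathToMatrix_edge, pathToMatrix_edge, o_bar, t_bar, Matrix.single_mul_single_same,
        aeval_eq_sum_range, Finset.mul_sum]
      simp only [mul_smul_comm, hpow, Matrix.smul_single]
      have := aeval_edgeGen (T := T) hF hP hy
      rw [aeval_eq_sum_range] at this
      rw [← Matrix.single_zero (Γ.o y) (Γ.o y), ← this]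
      exact (map_sum (Matrix.singleLinearMap K (Γ.o y) (Γ.o y)) _ _).symm

variable (hF : Γ.PropertyF Y₁ f) (hP : Γ.IsOrientation P)

theorem toMatrix_quotVertex (s : S) :
    toMatrix (T := T) hF hP (quotVertex Γ Y₁ f s) = Matrix.single s s 1 :=
  pathToMatrix_vertex hP s

theorem toMatrix_quotEdge (y : Y) : toMatrix (T := T) hF hP (quotEdge Γ Y₁ f y) =
    Matrix.single (Γ.o y) (Γ.t y) (edgeGen Y₁ f T hP y) :=
  pathToMatrix_edge hP y

theorem toMatrix_transport (hT₁ : T ⊆ Y₁) (hT : ∀ y ∈ T, Γ.bar y ∈ T)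
    {g : Y → Γ.RelationQuotient Y₁ f} (hg : Γ.IsTransport T (quotVertex Γ Y₁ f) g)
    (hgP : ∀ y ∈ P, g y = quotEdge Γ Y₁ f y) (s : S) (l : List Y) (hl : Γ.IsWalkFrom s l)
    (hlT : ∀ y ∈ l, y ∈ T) :
    toMatrix (T := T) hF hP (transport Γ (quotVertex Γ Y₁ f) g s l) =
      Matrix.single s (Γ.endVertex s l) 1 := by
  have hpos : ∀ y ∈ T, y ∈ P →
      toMatrix (T := T) hF hP (g y) = Matrix.single (Γ.o y) (Γ.t y) 1 := fun y hy hyP => by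
    rw [hgP y hyP, toMatrix_quotEdge, edgeGen_of_mem_tree hP hyP (hT₁ hy) hy]
  have hedge : ∀ y ∈ T, toMatrix (T := T) hF hP (g y) = Matrix.single (Γ.o y) (Γ.t y) 1 := by
    intro y hy
    by_cases hyP : y ∈ P
    · exact hpos y hy hyP
    · -- the image of `g y` is determined as the inverse of the image of `g ȳ`
      have h1 := hpos _ (hT y hy) ((hP.bar_mem_iff y).2 hyP)
      rw [o_bar, t_bar] at h1
      have h2 := congrArg (toMatrix (T := T) hF hP) (hg.mul_bar _ (hT y hy))
      rw [map_mul, h1, toMatrix_quotVertex, o_bar, Γ.bar_bar] at h2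
      rw [← hg.left y hy, map_mul, toMatrix_quotVertex,
        show (Matrix.single (Γ.o y) (Γ.o y) 1 : Matrix S S (EdgeProduct Y₁ f T P)) =
          Matrix.single (Γ.o y) (Γ.t y) 1 * Matrix.single (Γ.t y) (Γ.o y) 1 by simp,
        mul_assoc, h2, Matrix.single_mul_single_same, one_mul]
  induction l generalizing s with
  | nil => exact toMatrix_quotVertex hF hP s
  | cons y l ih =>
    obtain ⟨rfl, hl⟩ := hl
    rw [transport, map_mul, hedge y (hlT y (by simp)),
      ih _ hl fun z hz => hlT z (List.mem_cons_of_mem _ hz), Matrix.single_mul_single_same,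
      one_mul, endVertex]

/-- The quotient of the path algebra is a matrix ring over the free product, for every spanning
tree in `Y₁` and every orientation; the vertices are the diagonal elementary matrices. -/
theorem exists_algEquiv_matrix (hF : Γ.PropertyF Y₁ f) (hP : Γ.IsOrientation P)
    (tree : Γ.IsSpanningTree T) (hT₁ : T ⊆ Y₁) :
    ∃ Φ : Γ.RelationQuotient Y₁ f ≃ₐ[K] Matrix S S (EdgeProduct Y₁ f T P),
      ∀ s, Φ (quotVertex Γ Y₁ f s) = Matrix.single s s 1 := by
  obtain ⟨g, hg, hgP⟩ := exists_quot_isTransport hF hP tree.bar_mem hT₁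
  obtain ⟨e, he, hpath⟩ := hg.exists_isMatrixUnits tree (fun s t => quotVertex_mul_of_ne)
    sum_quotVertex
  have rep := quot_isRepresentation (Γ := Γ) (Y₁ := Y₁) (f := f) Set.univ
  have hdiag : ∀ s, e s s = quotVertex Γ Y₁ f s := fun s =>
    (hpath (Path.nil Γ s) (by simp [Path.nil])).symm
  have hedge : ∀ y ∈ T, e (Γ.o y) (Γ.t y) = g y := fun y hy =>
    (hpath (Path.ofEdge Γ y) (by simpa [Path.ofEdge] using hy)).symm.trans (hg.right y hy)
  have hφe : ∀ i j, toMatrix (T := T) hF hP (e i j) = Matrix.single i j 1 := fun i j => by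
    obtain ⟨p, rfl, rfl, hp⟩ := tree.connected i j
    rw [← hpath p hp]
    exact toMatrix_transport hF hP hT₁ tree.bar_mem hg hgP _ _ p.isWalk hp
  let b : Y → IsMatrixUnits.centralizer K e := fun y =>
    he.spread K (Γ.o y) (Γ.t y) (quotEdge Γ Y₁ f y)
  have hb : ∀ y ∈ Y₁, aeval (b y * b (Γ.bar y)) (f y) = 0 := fun y hy => by
    have h1 : b y * b (Γ.bar y) =
        he.spread K (Γ.o y) (Γ.o y) (quotEdge Γ Y₁ f y * quotEdge Γ Y₁ f (Γ.bar y)) := by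
      rw [he.spread_mul_spread, o_bar, t_bar, hdiag, rep.right y trivial]
    rw [h1, he.aeval_spread _ (by rw [hdiag, ← mul_assoc, rep.left y trivial]), hdiag,
      quot_relation hy, map_zero]
  have hbT : ∀ y ∈ T, y ∈ P → b y = 1 := fun y hy hyP => by
    change he.spread K _ _ _ = 1
    rw [← hgP y hyP, ← hedge y hy, he.spread_unit]
  obtain ⟨χ, hχ⟩ := exists_edgeProduct_hom hF hP b hb hbT
  let φ := toMatrix (T := T) hF hP
  let ψ := he.matrixHom χ
  have hscalar : ∀ q, φ (χ q) = Matrix.scalar S q := by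
    have : (φ.comp (IsMatrixUnits.centralizer K e).val).comp χ = Matrix.scalarAlgHom S K := by
      refine edgeProduct_hom_ext hP fun y => ?_
      change φ (χ (edgeGen Y₁ f T hP y)) = Matrix.scalar S (edgeGen Y₁ f T hP y)
      rw [hχ, he.coe_spread, map_sum]
      simp only [map_mul, φ, hφe, toMatrix_quotEdge, Matrix.single_mul_single_same, one_mul,
        mul_one]
      rw [Matrix.sum_single_eq_diagonal]
      rfl
    exact fun q => DFunLike.congr_fun this q
  refine ⟨AlgEquiv.ofAlgHom φ ψ ?_ ?_, toMatrix_quotVertex hF hP⟩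
  · refine matrix_algHom_ext (fun q => ?_) (fun i j => ?_)
    · have hψ : ψ (Matrix.scalar S q) = χ q := by
        have h1 : Matrix.scalar S q = ∑ s, Matrix.single s s q :=
          (Matrix.sum_single_eq_diagonal _).symm
        rw [h1, map_sum]
        simp only [ψ, he.matrixHom_single]
        rw [← Finset.mul_sum, he.sum_diag, mul_one]
      rw [AlgHom.comp_apply, hψ, hscalar]
      rfl
    · rw [AlgHom.comp_apply, he.matrixHom_single, map_one]
      exact (congrArg φ (one_mul _)).trans (hφe i j)
  · refine RingCon.Quotient.hom_extₐ (PathAlgebra.algHom_ext (fun s => ?_) (fun y => ?_))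
    · change ψ (φ (quotVertex Γ Y₁ f s)) = quotVertex Γ Y₁ f s
      rw [toMatrix_quotVertex, he.matrixHom_single, map_one, hdiag]
      exact one_mul _
    · change ψ (φ (quotEdge Γ Y₁ f y)) = quotEdge Γ Y₁ f y
      rw [toMatrix_quotEdge, he.matrixHom_single, hχ, he.spread_mul_unit, hdiag, hdiag,
        rep.left y trivial, rep.right y trivial]

end ToMatrix

end SerreGraph

theorem mainTheorem3 (K : Type u) [Field K] {S : Type v} {Y : Type w} [Fintype S] [Finite Y]
    (Γ : SerreGraph S Y) (Y₁ : Set Y) (f : Y → K[X]) (hF : Γ.PropertyF Y₁ f) :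
    -- the isomorphism
    (∀ T : Set Y, Γ.IsSpanningTree T → T ⊆ Y₁ →
      ∃ P : Set Y, Γ.IsOrientation P ∧
        Nonempty (Γ.RelationQuotient Y₁ f ≃ₐ[K]
          Matrix (Fin (Fintype.card S)) (Fin (Fintype.card S))
            (FactorProduct K (SerreGraph.factors Y₁ f T P)))) ∧
    -- independence of the spanning tree and of the orientation
    (∀ T T' P P' : Set Y, Γ.IsSpanningTree T → T ⊆ Y₁ → Γ.IsSpanningTree T' → T' ⊆ Y₁ →
      Γ.IsOrientation P → Γ.IsOrientation P' →
        Nonempty (FactorProduct K (SerreGraph.factors Y₁ f T P) ≃ₐ[K]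
          FactorProduct K (SerreGraph.factors Y₁ f T' P'))) ∧
    -- the decomposition of the algebra attached to an edge
    (∀ g : K[X], g.natDegree ≠ 0 → g.coeff 0 ≠ 0 →
      Nonempty (EdgeAlgebra K g ≃ₐ[K] FactorProduct K ![.laurent, .root g])) := by
  classical
  refine ⟨fun T tree hT => ?_, fun T T' P P' tree hT tree' hT' hP hP' => ?_,
    fun g _ h0 => nonempty_edgeAlgebra_algEquiv g h0⟩
  · obtain ⟨P, hP⟩ := Γ.exists_isOrientation
    obtain ⟨Φ, -⟩ := SerreGraph.exists_algEquiv_matrix hF hP tree hT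
    exact ⟨P, hP, ⟨Φ.trans (Matrix.reindexAlgEquiv K _ (Fintype.equivFin S))⟩⟩
  · obtain ⟨r⟩ := tree.nonempty
    obtain ⟨Φ, hΦ⟩ := SerreGraph.exists_algEquiv_matrix hF hP tree hT
    obtain ⟨Φ', hΦ'⟩ := SerreGraph.exists_algEquiv_matrix hF hP' tree' hT'
    refine nonempty_algEquiv_of_matrix (Φ.symm.trans Φ') r ?_
    rw [← hΦ r, AlgEquiv.trans_apply, AlgEquiv.symm_apply_apply, hΦ']
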